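/- Let $V$ be a finite-dimensional real Euclidean space. For $0\ne\alpha\in V$ let $s_\alpha$ be the orthogonal reflection in the hyperplane $\alpha^\perp$. Let $\Phi\subseteq V\setminus\{0\}$ be a finite set such that $s_\alpha(\beta)\in\Phi$ for all $\alpha,\beta\in\Phi$, and such that $\alpha,c\alpha\in\Phi$ with $c\in\mathbb R$ implies $c=\pm1$ (a root system, not necessarily crystallographic and not necessarily spanning $V$). Let $\Pi\subseteq\Phi$ be a simple system, i.e. a linearly independent subset such that, with $\Phi_+:=\Phi\cap\mathbb R_{\ge0}\Pi$, $\Phi$ is the disjoint union of $\Phi_+$ and $-\Phi_+$. Let $W$ be the (finite) group generated by the reflections $s_\alpha$ $(\alpha\in\Phi)$, let $S:=\{s_\alpha\mid\alpha\in\Pi\}$, and for $I\subseteq S$ let $W_I$ be the subgroup of $W$ generated by $I$. For $n\in\mathbb N$ (including $n=0$) let $\mathcal I^{(n)}$ be the set of all sequences $(I_0,I_1,\dots,I_n)$ of subsets of $S$ with $S=I_0\supseteq I_1\supseteq\dots\supseteq I_n$, and let $W$ act diagonally on $V^n$. Then for every $n$ and every $w\in W$, $$\det\nolimits_{V^n}(w)=\det\nolimits_V(w)^n=\sum_{(I_0,\dots,I_n)\in\mathcal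 I^{(n)}}(-1)^{|I_1|+\dots+|I_n|}\,\operatorname{Ind}_{W_{I_n}}^W(1)(w),$$ where $\operatorname{Ind}_{W_{I_n}}^W(1)$ is the character of the real representation of $W$ induced from the trivial representation of $W_{I_n}$. -/

import Mathlib

namespace EuclideanRoots

open scoped NNReal Pointwise

noncomputable section

/-- The orthogonal reflection `s_α` of `V` in the hyperplane orthogonal to `α`. -/
def rootReflection {V : Type*} [NormedAddCommGroup V] [InnerProductSpace ℝ V] (α : V) :
    V ≃ₗ[ℝ] V :=
  ((Submodule.span ℝ {α})ᗮ.reflection).toLinearEquiv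

/-- The usual formula `s_α(v) = v - ⟨v, α^∨⟩ α` with `α^∨ = (2 / ⟨α, α⟩) α`. -/
theorem rootReflection_apply {V : Type*} [NormedAddCommGroup V] [InnerProductSpace ℝ V]
    (α v : V) :
    rootReflection α v = v - inner ℝ v ((2 / inner ℝ α α : ℝ) • α) • α := by
  have h := Submodule.reflection_orthogonal_apply (K := Submodule.span ℝ {α}) v
  change (Submodule.span ℝ {α})ᗮ.reflection v = _
  rw [h, Submodule.reflection_apply, Submodule.starProjection_singleton, inner_smul_right,
    real_inner_self_eq_norm_sq, real_inner_comm v α]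
  simp only [RCLike.ofReal_real_eq_id, id, neg_sub, ← Nat.cast_smul_eq_nsmul ℝ, smul_smul]
  congr 2
  push_cast
  ring

/-- A (finite, reduced, not necessarily crystallographic and not necessarily spanning) root system
in a Euclidean space. -/
structure IsRootSystem {V : Type*} [NormedAddCommGroup V] [InnerProductSpace ℝ V]
    (Φ : Finset V) : Prop where
  zero_notMem : (0 : V) ∉ Φ
  reflection_mem : ∀ α ∈ Φ, ∀ β ∈ Φ, rootReflection α β ∈ Φ
  reduced : ∀ α ∈ Φ, ∀ c : ℝ, c • α ∈ Φ → c = 1 ∨ c = -1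

/-- `Φ₊ = Φ ∩ ℝ_{≥ 0} Δ`. -/
def positiveRoots {V : Type*} [NormedAddCommGroup V] [InnerProductSpace ℝ V]
    (Φ Δ : Finset V) : Set V :=
  (Φ : Set V) ∩ (Submodule.span ℝ≥0 (Δ : Set V) : Set V)

/-- `Δ` is a simple system of `Φ`: a linearly independent subset of `Φ` such that `Φ` is the
disjoint union of `Φ₊ = Φ ∩ ℝ_{≥ 0} Δ` and `-Φ₊`. -/
structure IsSimpleSystem {V : Type*} [NormedAddCommGroup V] [InnerProductSpace ℝ V]
    (Φ Δ : Finset V) : Prop where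
  subset : Δ ⊆ Φ
  linearIndepOn : LinearIndepOn ℝ id (Δ : Set V)
  eq_union : (Φ : Set V) = positiveRoots Φ Δ ∪ -positiveRoots Φ Δ
  disjoint : Disjoint (positiveRoots Φ Δ) (-positiveRoots Φ Δ)

/-- The reflection group `W` of `Φ`, generated by the reflections in the elements of `Φ`. -/
def reflectionGroup {V : Type*} [NormedAddCommGroup V] [InnerProductSpace ℝ V]
    (Φ : Finset V) : Subgroup (V ≃ₗ[ℝ] V) :=
  Subgroup.closure (rootReflection '' (Φ : Set V))

open Classical in
/-- The set `S` of simple reflections `s_α`, `α ∈ Δ`, as a set of elements of `W`. -/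
def simpleReflections {V : Type*} [NormedAddCommGroup V] [InnerProductSpace ℝ V]
    (Φ Δ : Finset V) : Finset (reflectionGroup Φ) :=
  (Δ.image rootReflection).subtype (· ∈ reflectionGroup Φ)

theorem mem_simpleReflections {V : Type*} [NormedAddCommGroup V] [InnerProductSpace ℝ V]
    {Φ Δ : Finset V} {w : reflectionGroup Φ} :
    w ∈ simpleReflections Φ Δ ↔ ∃ α ∈ Δ, rootReflection α = (w : V ≃ₗ[ℝ] V) := by
  simp [simpleReflections]

/-- The standard parabolic subgroup `W_I`, generated by a set `I` of elements of `W`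
(used for `I ⊆ S`). -/
def parabolic {V : Type*} [NormedAddCommGroup V] [InnerProductSpace ℝ V]
    {Φ : Finset V} (I : Finset (reflectionGroup Φ)) : Subgroup (reflectionGroup Φ) :=
  Subgroup.closure (I : Set (reflectionGroup Φ))

open Classical in
/-- The set `𝓘⁽ⁿ⁾` of weakly decreasing sequences `S = I₀ ⊇ I₁ ⊇ ⋯ ⊇ Iₙ` of subsets of `S`. -/
def chains {V : Type*} [NormedAddCommGroup V] [InnerProductSpace ℝ V]
    (Φ Δ : Finset V) (n : ℕ) : Finset (Fin (n + 1) → Finset (reflectionGroup Φ)) :=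
  (Fintype.piFinset fun _ => (simpleReflections Φ Δ).powerset).filter
    fun I => I 0 = simpleReflections Φ Δ ∧ Antitone I

theorem mem_chains {V : Type*} [NormedAddCommGroup V] [InnerProductSpace ℝ V]
    {Φ Δ : Finset V} {n : ℕ} {I : Fin (n + 1) → Finset (reflectionGroup Φ)} :
    I ∈ chains Φ Δ n ↔ I 0 = simpleReflections Φ Δ ∧ Antitone I := by
  simp only [chains, Finset.mem_filter, Fintype.mem_piFinset, Finset.mem_powerset,
    and_iff_right_iff_imp]
  rintro ⟨h0, hI⟩ i
  exact h0 ▸ hI (Fin.zero_le i)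

/-- The character of `Ind_H^G(1)`, the (real) representation of `G` induced from the trivial
one-dimensional representation of the subgroup `H`. -/
def inducedTrivialCharacter {G : Type*} [Group G] (H : Subgroup G) (g : G) : ℝ :=
  (Representation.ind H.subtype (Representation.trivial ℝ H ℝ)).character g

end

end EuclideanRoots

/-!
Let `U` be the fixed space of `w ∈ W`. The hyperplanes orthogonal to the roots cut `V` into cells,
which are the translates `g C_K` of the faces of the fundamental chamber, `K ⊆ Δ`; the cell `g C_K`
has dimension `dim V - |K|` and stabilizer `g W_K g⁻¹`, and it is contained in `U` as soon as it
meets `U`. So the value of `Ind_{W_K}^W(1)` at `w` is the number of cells of type `K` in `U`, and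
the Euler relation for the arrangement restricted to `U` gives
`∑_{K ⊆ Δ} (-1)^|K| Ind_{W_K}^W(1)(w) = (-1)^(dim V - dim U) = det w`, which is Solomon's formula.

Applying this to the parabolic subgroup `W_I` and inducing to `W` gives
`∑_{K ⊆ I} (-1)^|K| Ind_{W_K}^W(1) = det · Ind_{W_I}^W(1)` for every `I ⊆ Δ`. In the sum over
decreasing sequences, summing over the last term while the others stay fixed therefore splits off
one factor `det`, and induction on `n` finishes the proof.
-/

namespace EuclideanRoots

open scoped NNReal

noncomputable section

section InducedCharacter

open MonoidAlgebra Representation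

variable {k G : Type*} [Group G]

theorem indV_mk_mul [CommRing k] (H : Subgroup G) (h : H) (x : G) (a : k) :
    IndV.mk H.subtype (trivial k H k) (h * x) a = IndV.mk H.subtype (trivial k H k) x a := by
  simpa using Coinvariants.mk_self_apply
    (Representation.tprod ((leftRegular k G).comp H.subtype) (trivial k H k)) h
    (TensorProduct.tmul k (MonoidAlgebra.single x 1) a)

variable (k) in
/-- `Ind_H^G(1)` is the permutation representation on `G ⧸ H`. Mathlib's model of `Ind_H^G` is a
space of coinvariants for left multiplication by `H`, hence the inverse in `x ↦ x⁻¹ H`. -/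
def indTrivialEquiv [CommRing k] (H : Subgroup G) :
    (ind H.subtype (trivial k H k)).Equiv (ofMulAction k G (G ⧸ H)) :=
  .mk (LinearEquiv.ofLinearMap
    (Coinvariants.lift _
      (TensorProduct.lift
        ((Finsupp.lsum k fun x : G => LinearMap.toSpanSingleton k (k →ₗ[k] k[G ⧸ H])
          (MonoidAlgebra.lsingle ((x⁻¹ : G) : G ⧸ H))) ∘ₗ (coeffLinearEquiv k).toLinearMap))
      (by
        intro h
        ext x
        simp))
    ((Finsupp.lsum k fun q : G ⧸ H => IndV.mk H.subtype (trivial k H k) (q.out)⁻¹) ∘ₗ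
      (coeffLinearEquiv k).toLinearMap)
    (by
      ext q
      simp)
    (by
      ext x
      obtain ⟨h, hh⟩ := QuotientGroup.mk_out_eq_mul H x⁻¹
      simpa [hh] using indV_mk_mul H h⁻¹ x (1 : k)))
    (by
      intro g
      ext x
      simp)

theorem character_ofMulAction {X : Type*} [Field k] [MulAction G X] [Finite X] (g : G) :
    (ofMulAction k G X).character g = Nat.card (MulAction.fixedBy X g) := by
  classical
  have := Fintype.ofFinite X
  rw [character, LinearMap.trace_eq_matrix_trace k (Module.Basis.ofRepr (coeffLinearEquiv k)),
    Matrix.trace]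
  simp [LinearMap.toMatrix_apply, Finsupp.single_apply, Finset.sum_boole, Nat.card_eq_fintype_card,
    Fintype.card_subtype, MulAction.fixedBy]

theorem inducedTrivialCharacter_eq_card_fixedBy [Finite G] (H : Subgroup G) (g : G) :
    inducedTrivialCharacter H g = Nat.card (MulAction.fixedBy (G ⧸ H) g) :=
  (congrFun (char_iso (indTrivialEquiv ℝ H)) g).trans (character_ofMulAction g)

theorem card_fixedBy_quotient_mul_card (H : Subgroup G) (g : G) :
    Nat.card (MulAction.fixedBy (G ⧸ H) g) * Nat.card H =
      Nat.card {x : G // x⁻¹ * g * x ∈ H} := by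
  rw [mul_comm, ← Nat.card_prod,
    ← Nat.card_congr (QuotientGroup.preimageMkEquivSubgroupProdSet H _)]
  refine Nat.card_congr (Equiv.subtypeEquivRight fun x => ?_)
  rw [Set.mem_preimage, MulAction.mem_fixedBy, MulAction.Quotient.smul_coe, eq_comm,
    QuotientGroup.eq, smul_eq_mul, mul_assoc]

theorem card_eq_card_image_mul_card {H : Subgroup G} {s : Set G} {X : Type*} {f : G → X}
    (hs : ∀ g ∈ s, ∀ b ∈ H, g * b ∈ s) (hf : ∀ g ∈ s, ∀ h ∈ s, f g = f h ↔ h⁻¹ * g ∈ H) :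
    Nat.card s = Nat.card (f '' s) * Nat.card H := by
  choose r hr hfr using fun t : f '' s => t.2
  have hmul (t : f '' s) (b : H) : f (r t * b) = t := by
    rw [← hfr, hf _ (hs _ (hr t) b b.2) _ (hr t), inv_mul_cancel_left]
    exact b.2
  rw [← Nat.card_prod]
  refine (Nat.card_congr (Equiv.ofBijective
    (fun p : (f '' s) × H => (⟨r p.1 * p.2, hs _ (hr p.1) p.2 p.2.2⟩ : s)) ⟨?_, ?_⟩)).symm
  · rintro ⟨t, b⟩ ⟨t', b'⟩ h
    have hmul_eq : r t * b = r t' * b' := congrArg Subtype.val h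
    obtain rfl : t = t' := Subtype.ext (by rw [← hmul t b, hmul_eq, hmul])
    rw [Subtype.ext (mul_left_cancel hmul_eq)]
  · rintro ⟨g, hg⟩
    let t : f '' s := ⟨f g, g, hg, rfl⟩
    exact ⟨(t, ⟨_, (hf g hg (r t) (hr t)).1 (hfr t).symm⟩), Subtype.ext (mul_inv_cancel_left _ g)⟩

/-- Frobenius' formula for the class function of `A` induced from a class function `φ` of its
subgroup `B`. Both are subgroups of an ambient group `G`, and functions are defined on all of `G`,
so that different pairs of subgroups can be compared; only the values of `φ` on `B` matter. -/
def inducedFunction [Field k] (A B : Subgroup G) (φ : G → k) (w : G) : k :=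
  (Nat.card B : k)⁻¹ * ∑ᶠ x : A, (B : Set G).indicator φ ((x : G)⁻¹ * w * x)

theorem inducedFunction_def [Field k] (A B : Subgroup G) [Fintype A] (φ : G → k) (w : G) :
    inducedFunction A B φ w =
      (Nat.card B : k)⁻¹ * ∑ x : A, (B : Set G).indicator φ ((x : G)⁻¹ * w * x) := by
  rw [inducedFunction, finsum_eq_sum_of_fintype]

theorem inducedFunction_one [Field k] (A B : Subgroup G) [Finite A] (w : G) :
    inducedFunction A B (1 : G → k) w =
      (Nat.card B : k)⁻¹ * Nat.card {x : A // (x : G)⁻¹ * w * x ∈ B} := by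
  classical
  have := Fintype.ofFinite A
  rw [inducedFunction_def, Nat.card_eq_fintype_card (α := {x : A // _}), Fintype.card_subtype,
    ← Finset.sum_boole]
  simp [Set.indicator_apply]

theorem inducedTrivialCharacter_eq_inducedFunction {A : Subgroup G} [Finite A] (H : Subgroup A)
    (w : A) : inducedTrivialCharacter H w = inducedFunction A (H.map A.subtype) 1 (w : G) := by
  have hH : Nat.card (H.map A.subtype) = Nat.card H :=
    Nat.card_congr (H.equivMapOfInjective _ A.subtype_injective).symm.toEquiv
  rw [inducedTrivialCharacter_eq_card_fixedBy, inducedFunction_one, hH, eq_inv_mul_iff_mul_eq₀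
    (Nat.cast_ne_zero.2 Nat.card_pos.ne'), mul_comm, ← Nat.cast_mul, card_fixedBy_quotient_mul_card]
  exact_mod_cast Nat.card_congr <| Equiv.subtypeEquivRight fun x =>
    (Subgroup.mem_map_iff_mem (x := x⁻¹ * w * x) A.subtype_injective).symm

variable [Field k] {A B C : Subgroup G} {φ ψ : G → k}

theorem inducedFunction_one_eq_card_image [CharZero k] [Finite A] (hBA : B ≤ A) {X : Type*}
    {f : G → X} (hf : ∀ g ∈ A, ∀ h ∈ A, f g = f h ↔ h⁻¹ * g ∈ B) (w : G) :
    inducedFunction A B (1 : G → k) w = Nat.card (f '' {g | g ∈ A ∧ g⁻¹ * w * g ∈ B}) := by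
  have : Finite B := Finite.of_injective _ (Subgroup.inclusion_injective hBA)
  set s := {g | g ∈ A ∧ g⁻¹ * w * g ∈ B}
  have hmul : ∀ g ∈ s, ∀ b ∈ B, g * b ∈ s := fun g hg b hb => ⟨A.mul_mem hg.1 (hBA hb), by
    simpa only [mul_inv_rev, mul_assoc] using B.mul_mem (B.mul_mem (B.inv_mem hb) hg.2) hb⟩
  have hcard : Nat.card {x : A // (x : G)⁻¹ * w * x ∈ B} = Nat.card s :=
    Nat.card_congr (Equiv.subtypeSubtypeEquivSubtypeInter (· ∈ A) fun g : G => g⁻¹ * w * g ∈ B)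
  rw [inducedFunction_one, hcard,
    card_eq_card_image_mul_card hmul fun g hg h hh => hf g hg.1 h hh.1, Nat.cast_mul, mul_comm,
    mul_inv_cancel_right₀ (Nat.cast_ne_zero.2 Nat.card_pos.ne')]

theorem inducedFunction_congr (h : ∀ x ∈ B, φ x = ψ x) :
    inducedFunction A B φ = inducedFunction A B ψ := by
  funext w
  rw [inducedFunction, inducedFunction, Set.indicator_congr h]

theorem inducedFunction_sum [Finite A] {ι : Type*} (s : Finset ι) (c : ι → k) (φ : ι → G → k)
    (w : G) : inducedFunction A B (fun x => ∑ i ∈ s, c i * φ i x) w =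
      ∑ i ∈ s, c i * inducedFunction A B (φ i) w := by
  have := Fintype.ofFinite A
  simp only [inducedFunction_def, Finset.mul_sum, mul_left_comm (c _)]
  rw [Finset.sum_comm]
  refine Finset.sum_congr rfl fun x _ => ?_
  by_cases hx : (x : G)⁻¹ * w * x ∈ (B : Set G) <;> simp [hx, Finset.mul_sum]

theorem inducedFunction_mul [Finite A] {d : G → k} (hd : ∀ x w, d (x⁻¹ * w * x) = d w) (w : G) :
    inducedFunction A B (fun x => d x * φ x) w = d w * inducedFunction A B φ w := by
  have := Fintype.ofFinite A
  simp only [inducedFunction_def, Set.indicator_mul_right, hd, ← Finset.mul_sum, mul_left_comm]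

theorem inducedFunction_self [CharZero k] [Finite A] (hφ : ∀ x ∈ A, ∀ w, φ (x⁻¹ * w * x) = φ w)
    {w : G} (hw : w ∈ A) : inducedFunction A A φ w = φ w := by
  have := Fintype.ofFinite A
  have hmem (x : A) : (x : G)⁻¹ * w * x ∈ (A : Set G) :=
    A.mul_mem (A.mul_mem (A.inv_mem x.2) hw) x.2
  simp [inducedFunction_def, Set.indicator_of_mem (hmem _), hφ, Nat.card_eq_fintype_card]

theorem inducedFunction_trans [CharZero k] [Finite A] (hBA : B ≤ A) (hCB : C ≤ B) (φ : G → k) :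
    inducedFunction A B (inducedFunction B C φ) = inducedFunction A C φ := by
  funext w
  have : Finite B := Finite.of_injective _ (Subgroup.inclusion_injective hBA)
  have := Fintype.ofFinite A
  have := Fintype.ofFinite B
  have hconj (x : A) : (B : Set G).indicator (inducedFunction B C φ) ((x : G)⁻¹ * w * x) =
      (Nat.card C : k)⁻¹ *
        ∑ y : B, (C : Set G).indicator φ (((x * y : G))⁻¹ * w * (x * y)) := by
    simp only [mul_inv_rev, mul_assoc]
    by_cases hx : (x : G)⁻¹ * w * x ∈ (B : Set G)
    · rw [Set.indicator_of_mem (by simpa [mul_assoc] using hx), inducedFunction_def]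
      simp only [mul_assoc]
    · rw [Set.indicator_of_notMem (by simpa [mul_assoc] using hx), Finset.sum_eq_zero, mul_zero]
      refine fun y _ => Set.indicator_of_notMem (fun hy => hx ?_) _
      simpa [mul_assoc] using B.mul_mem (B.mul_mem y.2 (hCB hy)) (B.inv_mem y.2)
  have hshift (y : B) : ∑ x : A, (C : Set G).indicator φ (((x * y : G))⁻¹ * w * (x * y)) =
      ∑ x : A, (C : Set G).indicator φ ((x : G)⁻¹ * w * x) :=
    Fintype.sum_equiv (Equiv.mulRight (Subgroup.inclusion hBA y)) _ _ fun _ => rfl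
  rw [inducedFunction_def, inducedFunction_def]
  simp only [hconj, ← Finset.mul_sum]
  rw [Finset.sum_comm]
  simp only [hshift, Finset.sum_const, Finset.card_univ, nsmul_eq_mul, Nat.card_eq_fintype_card]
  rw [mul_left_comm, inv_mul_cancel_left₀ (Nat.cast_ne_zero.2 Fintype.card_ne_zero)]

theorem sum_inducedFunction_one_of_eqOn [CharZero k] [Finite A] {ι : Type*} {s : Finset ι}
    {C : ι → Subgroup G} {c : ι → k} {d : G → k} (hBA : B ≤ A) (hCB : ∀ i ∈ s, C i ≤ B)
    (hd : ∀ x w, d (x⁻¹ * w * x) = d w)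
    (h : ∀ w ∈ B, ∑ i ∈ s, c i * inducedFunction B (C i) 1 w = d w) (w : G) :
    ∑ i ∈ s, c i * inducedFunction A (C i) 1 w = d w * inducedFunction A B 1 w :=
  calc
    ∑ i ∈ s, c i * inducedFunction A (C i) 1 w
        = inducedFunction A B (fun x => ∑ i ∈ s, c i * inducedFunction B (C i) 1 x) w := by
          rw [inducedFunction_sum]
          exact Finset.sum_congr rfl fun i hi => by rw [inducedFunction_trans hBA (hCB i hi)]
    _ = inducedFunction A B (fun x => d x * (1 : G → k) x) w :=
          congrFun (inducedFunction_congr fun x hx => by simp [h x hx]) w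
    _ = d w * inducedFunction A B 1 w := inducedFunction_mul hd w

end InducedCharacter

section DecreasingSequences

open Matrix

variable {α : Type*} {n : ℕ} {S : Finset α}

open Classical in
/-- The weakly decreasing sequences `S = I₀ ⊇ I₁ ⊇ ⋯ ⊇ Iₙ` of finite subsets of a type. -/
def decreasingSequences (S : Finset α) (n : ℕ) : Finset (Fin (n + 1) → Finset α) :=
  (Fintype.piFinset fun _ => S.powerset).filter fun I => I 0 = S ∧ Antitone I

theorem mem_decreasingSequences {I : Fin (n + 1) → Finset α} :
    I ∈ decreasingSequences S n ↔ I 0 = S ∧ Antitone I := by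
  simp only [decreasingSequences, Finset.mem_filter, Fintype.mem_piFinset, Finset.mem_powerset,
    and_iff_right_iff_imp]
  rintro ⟨h0, hI⟩ i
  exact h0 ▸ hI (Fin.zero_le i)

theorem vecCons_mem_decreasingSequences {K : Finset α} (hK : K ⊆ S) {I : Fin (n + 1) → Finset α}
    (hI : I ∈ decreasingSequences K n) : vecCons S I ∈ decreasingSequences S (n + 1) := by
  rw [mem_decreasingSequences] at hI ⊢
  exact ⟨rfl, antitone_vecCons.2 ⟨hI.1.trans_subset hK, hI.2⟩⟩

theorem vecTail_mem_decreasingSequences {I : Fin (n + 2) → Finset α}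
    (hI : I ∈ decreasingSequences S (n + 1)) : vecTail I ∈ decreasingSequences (I 1) n :=
  mem_decreasingSequences.2
    ⟨rfl, (mem_decreasingSequences.1 hI).2.comp_monotone (Fin.strictMono_succ).monotone⟩

theorem decreasingSequences_zero : decreasingSequences S 0 = {fun _ => S} := by
  ext I
  rw [mem_decreasingSequences, Finset.mem_singleton, funext_iff, Fin.forall_fin_one]
  exact and_iff_left (Subsingleton.antitone (α := Fin 1) I)

theorem sum_decreasingSequences_succ {M : Type*} [AddCommMonoid M]
    (F : (Fin (n + 2) → Finset α) → M) :
    ∑ I ∈ decreasingSequences S (n + 1), F I =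
      ∑ K ∈ S.powerset, ∑ I ∈ decreasingSequences K n, F (vecCons S I) := by
  have hcons : ∀ I ∈ decreasingSequences S (n + 1), vecCons S (vecTail I) = I := fun I hI => by
    rw [← (mem_decreasingSequences.1 hI).1]
    exact cons_head_tail I
  rw [Finset.sum_sigma']
  refine Finset.sum_nbij' (fun I => ⟨I 1, vecTail I⟩) (fun p => vecCons S p.2) ?_ ?_ hcons ?_
    fun I hI => by rw [hcons I hI]
  · intro I hI
    refine Finset.mem_sigma.2 ⟨Finset.mem_powerset.2 ?_, vecTail_mem_decreasingSequences hI⟩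
    exact (mem_decreasingSequences.1 hI).1 ▸ (mem_decreasingSequences.1 hI).2 (Fin.zero_le 1)
  · rintro ⟨K, I⟩ hI
    obtain ⟨hK, hI⟩ := Finset.mem_sigma.1 hI
    exact vecCons_mem_decreasingSequences (Finset.mem_powerset.1 hK) hI
  · rintro ⟨K, I⟩ hI
    obtain rfl : I 0 = K := (mem_decreasingSequences.1 (Finset.mem_sigma.1 hI).2).1
    rfl

theorem sum_decreasingSequences {R : Type*} [CommRing R] (P : Finset α → R) (d : R) (n : ℕ)
    (h : ∀ I ⊆ S, ∑ K ∈ I.powerset, (-1) ^ K.card * P K = d * P I) :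
    ∑ I ∈ decreasingSequences S n, (-1) ^ (∑ i : Fin n, (I i.succ).card) * P (I (Fin.last n)) =
      d ^ n * P S := by
  induction n generalizing S with
  | zero => simp [decreasingSequences_zero]
  | succ n ih =>
    have hstep : ∀ K ∈ S.powerset, (∑ I ∈ decreasingSequences K n,
        (-1) ^ (∑ i : Fin (n + 1), (vecCons S I i.succ).card) * P (vecCons S I (Fin.last _))) =
          d ^ n * ((-1) ^ K.card * P K) := by
      intro K hK
      rw [mul_left_comm, ← ih fun I hI => h I (hI.trans (Finset.mem_powerset.1 hK)),
        Finset.mul_sum]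
      refine Finset.sum_congr rfl fun I hI => ?_
      rw [← mul_assoc, ← pow_add, Fin.sum_univ_succ, ← (mem_decreasingSequences.1 hI).1]
      simp [← Fin.succ_last]
    rw [sum_decreasingSequences_succ, Finset.sum_congr rfl hstep, ← Finset.mul_sum,
      h S Finset.Subset.rfl, pow_succ, mul_assoc]

end DecreasingSequences

section EulerRelation

open Filter Module

variable {ι 𝕜 E : Type*} [Field 𝕜] [AddCommGroup E] [Module 𝕜 E] {f : ι → Dual 𝕜 E}
  {σ : ι → SignType} {g : Dual 𝕜 E} {x y v : E}

/-- The intersection of the hyperplanes `ker (f i)` with `σ i = 0`; if `σ` is the sign vector of a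
cell of the arrangement of all these hyperplanes, this is the linear span of the cell. -/
def flat (f : ι → Dual 𝕜 E) (σ : ι → SignType) : Submodule 𝕜 E :=
  ⨅ (i) (_ : σ i = 0), LinearMap.ker (f i)

theorem mem_flat : v ∈ flat f σ ↔ ∀ i, σ i = 0 → f i v = 0 := by
  simp only [flat, Submodule.mem_iInf, LinearMap.mem_ker]

theorem flat_domRestrict (f : ι → Dual 𝕜 E) (p : Submodule 𝕜 E) :
    flat (fun i => (f i).domRestrict p) σ = (flat f σ).comap p.subtype := by
  ext v
  simp [mem_flat]

theorem flat_option_elim_zero (f : Option ι → Dual 𝕜 E) :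
    flat f (fun o => o.elim 0 σ) = LinearMap.ker (f none) ⊓ flat (f ∘ some) σ := by
  ext v
  simp [mem_flat, Option.forall]

theorem flat_option_elim_of_ne_zero (f : Option ι → Dual 𝕜 E) {s : SignType} (hs : s ≠ 0) :
    flat f (fun o => o.elim s σ) = flat (f ∘ some) σ := by
  ext v
  simp [mem_flat, Option.forall, hs]

theorem finrank_ker_inf_add_one [FiniteDimensional 𝕜 E] {p : Submodule 𝕜 E} (hv : v ∈ p)
    (hg : g v ≠ 0) : finrank 𝕜 (LinearMap.ker g ⊓ p : Submodule 𝕜 E) + 1 = finrank 𝕜 p := by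
  have hne : g.domRestrict p ≠ 0 := fun h => hg (by simpa using LinearMap.congr_fun h ⟨v, hv⟩)
  rw [← Dual.finrank_ker_add_one_of_ne_zero hne, LinearMap.ker_domRestrict, inf_comm,
    ← Submodule.map_comap_subtype, LinearEquiv.finrank_eq (Submodule.equivSubtypeMap p _)]

variable [LinearOrder 𝕜]

/-- The sign vector of `x` with respect to a family of linear forms. The sets of vectors with a
given sign vector are the cells of the arrangement of the hyperplanes `ker (f i)`. -/
def signVector (f : ι → Dual 𝕜 E) (x : E) (i : ι) : SignType :=
  SignType.sign (f i x)

theorem mem_flat_signVector : v ∈ flat f (signVector f x) ↔ ∀ i, f i x = 0 → f i v = 0 := by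
  simp only [mem_flat, signVector, sign_eq_zero_iff]

/-- The covectors of a family of linear forms, i.e. its sign vectors; they index the cells of the
arrangement. -/
def covectors [Finite ι] (f : ι → Dual 𝕜 E) : Finset (ι → SignType) :=
  (Set.toFinite (Set.range (signVector f))).toFinset

theorem mem_covectors [Finite ι] : σ ∈ covectors f ↔ ∃ x, signVector f x = σ := by
  rw [covectors, Set.Finite.mem_toFinset, Set.mem_range]

open Classical in
/-- The signs which the linear form `g` takes on the cell with sign vector `σ`. -/
def signsOnCell (f : ι → Dual 𝕜 E) (σ : ι → SignType) (g : Dual 𝕜 E) : Finset SignType :=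
  Finset.univ.filter fun s => ∃ x, signVector f x = σ ∧ SignType.sign (g x) = s

theorem mem_signsOnCell {s : SignType} :
    s ∈ signsOnCell f σ g ↔ ∃ x, signVector f x = σ ∧ SignType.sign (g x) = s := by
  simp [signsOnCell]

theorem sum_covectors_option [Finite ι] {M : Type*} [AddCommMonoid M] (f : Option ι → Dual 𝕜 E)
    (F : (Option ι → SignType) → M) :
    ∑ σ ∈ covectors f, F σ = ∑ τ ∈ covectors (f ∘ some),
      ∑ s ∈ signsOnCell (f ∘ some) τ (f none), F (fun o => o.elim s τ) := by
  have helim (σ : Option ι → SignType) : (fun o => o.elim (σ none) (σ ∘ some)) = σ :=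
    funext (Option.rec rfl fun _ => rfl)
  rw [Finset.sum_sigma']
  refine Finset.sum_nbij' (fun σ => ⟨σ ∘ some, σ none⟩) (fun p o => o.elim p.2 p.1) ?_ ?_
    (fun σ _ => helim σ) (fun _ _ => rfl) (fun σ _ => by rw [helim])
  · intro σ hσ
    obtain ⟨x, rfl⟩ := mem_covectors.1 hσ
    exact Finset.mem_sigma.2 ⟨mem_covectors.2 ⟨x, rfl⟩, mem_signsOnCell.2 ⟨x, rfl, rfl⟩⟩
  · rintro ⟨τ, s⟩ h
    obtain ⟨x, rfl, rfl⟩ := mem_signsOnCell.1 (Finset.mem_sigma.1 h).2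
    exact mem_covectors.2 ⟨x, (helim (signVector f x)).symm⟩

variable [IsStrictOrderedRing 𝕜]

theorem signVector_smul_add_smul {a b : 𝕜} (ha : 0 < a) (hb : 0 < b)
    (h : signVector f x = signVector f y) : signVector f (a • x + b • y) = signVector f x := by
  funext i
  have hi := congrFun h i
  simp only [signVector, map_add, map_smul, smul_eq_mul] at hi ⊢
  rcases lt_trichotomy (f i x) 0 with hx | hx | hx
  · have hy : f i y < 0 := by rwa [sign_neg hx, eq_comm, sign_eq_neg_one_iff] at hi
    rw [sign_neg hx, sign_neg (add_neg (mul_neg_of_pos_of_neg ha hx)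
      (mul_neg_of_pos_of_neg hb hy))]
  · have hy : f i y = 0 := by rwa [hx, sign_zero, eq_comm, sign_eq_zero_iff] at hi
    simp [hx, hy]
  · have hy : 0 < f i y := by rwa [sign_pos hx, eq_comm, sign_eq_one_iff] at hi
    rw [sign_pos hx, sign_pos (by positivity)]

theorem eventually_signVector_smul_add [Finite ι] (hv : v ∈ flat f (signVector f x)) :
    ∀ᶠ t : 𝕜 in atTop, signVector f (t • x + v) = signVector f x := by
  simp only [funext_iff, signVector, map_add, map_smul, smul_eq_mul]
  refine eventually_all.2 fun i => ?_
  rcases lt_trichotomy (f i x) 0 with hx | hx | hx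
  · filter_upwards [(tendsto_atBot_add_const_right _ (f i v)
      (tendsto_id.atTop_mul_const_of_neg hx)).eventually_lt_atBot 0] with t ht
    exact (sign_neg ht).trans (sign_neg hx).symm
  · simp [hx, mem_flat_signVector.1 hv i hx]
  · filter_upwards [(tendsto_atTop_add_const_right _ (f i v)
      (tendsto_id.atTop_mul_const hx)).eventually_gt_atTop 0] with t ht
    exact (sign_pos ht).trans (sign_pos hx).symm

theorem signsOnCell_eq_univ [Finite ι] (hx : signVector f x = σ) (hgx : g x = 0)
    (hv : v ∈ flat f σ) (hgv : g v ≠ 0) : signsOnCell f σ g = Finset.univ := by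
  have hmem : ∀ u ∈ flat f σ, SignType.sign (g u) ∈ signsOnCell f σ g := by
    intro u hu
    obtain ⟨t, ht⟩ := (eventually_signVector_smul_add (hx.symm ▸ hu)).exists
    exact mem_signsOnCell.2 ⟨t • x + u, ht.trans hx, by simp [hgx]⟩
  wlog hpos : 0 < g v generalizing v
  · exact this (neg_mem hv) (by simpa using hgv)
      (by simpa using lt_of_le_of_ne (not_lt.1 hpos) hgv)
  refine Finset.eq_univ_of_forall fun s => ?_
  rcases s.trichotomy with rfl | rfl | rfl
  · simpa [hpos] using hmem _ (neg_mem hv)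
  · simpa using hmem 0 (zero_mem _)
  · simpa [hpos] using hmem v hv

theorem sign_eq_of_mem_signsOnCell (h : 0 ∉ signsOnCell f σ g) (hx : signVector f x = σ)
    (hy : signVector f y = σ) : SignType.sign (g x) = SignType.sign (g y) := by
  have hne : ∀ z, signVector f z = σ → g z ≠ 0 := fun z hz hgz =>
    h (mem_signsOnCell.2 ⟨z, hz, by simp [hgz]⟩)
  have hlt : ∀ x y, signVector f x = σ → signVector f y = σ → g x < 0 → ¬0 < g y := by
    intro x y hx hy hgx hgy
    refine hne (g y • x + -g x • y) ?_ (by simp [mul_comm])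
    rw [signVector_smul_add_smul hgy (neg_pos.2 hgx) (hx.trans hy.symm), hx]
  rcases lt_or_gt_of_ne (hne x hx) with hgx | hgx <;>
    rcases lt_or_gt_of_ne (hne y hy) with hgy | hgy
  · rw [sign_neg hgx, sign_neg hgy]
  · exact absurd hgy (hlt x y hx hy hgx)
  · exact absurd hgx (hlt y x hy hx hgy)
  · rw [sign_pos hgx, sign_pos hgy]

theorem signsOnCell_eq_univ_or_singleton [Finite ι] (hx : signVector f x = σ) (g : Dual 𝕜 E) :
    (signsOnCell f σ g = Finset.univ ∧ ∃ v ∈ flat f σ, g v ≠ 0) ∨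
      ∃ s, signsOnCell f σ g = {s} ∧ (s = 0 → flat f σ ≤ LinearMap.ker g) := by
  by_cases hcut : 0 ∈ signsOnCell f σ g ∧ ∃ v ∈ flat f σ, g v ≠ 0
  · obtain ⟨h0, v, hv, hgv⟩ := hcut
    obtain ⟨z, hz, hgz⟩ := mem_signsOnCell.1 h0
    exact .inl ⟨signsOnCell_eq_univ hz (sign_eq_zero_iff.1 hgz) hv hgv, v, hv, hgv⟩
  have hker : SignType.sign (g x) = 0 → flat f σ ≤ LinearMap.ker g := fun hgx v hv => by
    by_contra hgv
    exact hcut ⟨mem_signsOnCell.2 ⟨x, hx, hgx⟩, v, hv, hgv⟩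
  refine .inr ⟨SignType.sign (g x), Finset.eq_singleton_iff_unique_mem.2
    ⟨mem_signsOnCell.2 ⟨x, hx, rfl⟩, fun s hs => ?_⟩, hker⟩
  obtain ⟨y, hy, rfl⟩ := mem_signsOnCell.1 hs
  by_cases h0 : 0 ∈ signsOnCell f σ g
  · have hg : ∀ v ∈ flat f σ, g v = 0 := fun v hv => by_contra fun h => hcut ⟨h0, v, hv, h⟩
    have hsub : y - x ∈ flat f σ := mem_flat.2 fun i hi => by
      have hxi : f i x = 0 := sign_eq_zero_iff.1 ((congrFun hx i).trans hi)
      have hyi : f i y = 0 := sign_eq_zero_iff.1 ((congrFun hy i).trans hi)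
      rw [map_sub, hxi, hyi, sub_zero]
    rw [sub_eq_zero.1 ((map_sub g y x).symm.trans (hg _ hsub))]
  · exact sign_eq_of_mem_signsOnCell h0 hy hx

variable [FiniteDimensional 𝕜 E]

theorem sum_signsOnCell_neg_one_pow_finrank [Finite ι] (f : Option ι → Dual 𝕜 E)
    (hσ : σ ∈ covectors (f ∘ some)) :
    ∑ s ∈ signsOnCell (f ∘ some) σ (f none),
        (-1 : ℤ) ^ finrank 𝕜 (flat f fun o => o.elim s σ) =
      (-1) ^ finrank 𝕜 (flat (f ∘ some) σ) := by
  obtain ⟨x, hx⟩ := mem_covectors.1 hσ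
  obtain ⟨huniv, v, hv, hgv⟩ | ⟨s, hs, hker⟩ := signsOnCell_eq_univ_or_singleton hx (f none)
  · have hunivSign : (Finset.univ : Finset SignType) = {0, -1, 1} := rfl
    rw [huniv, hunivSign, Finset.sum_insert (by decide), Finset.sum_insert (by decide),
      Finset.sum_singleton, flat_option_elim_zero, flat_option_elim_of_ne_zero f (by decide),
      flat_option_elim_of_ne_zero f (by decide), ← finrank_ker_inf_add_one hv hgv]
    ring
  · rw [hs, Finset.sum_singleton]
    by_cases h0 : s = 0
    · rw [h0, flat_option_elim_zero, inf_eq_right.2 (hker h0)]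
    · rw [flat_option_elim_of_ne_zero f h0]

theorem sum_covectors_neg_one_pow_finrank [Finite ι] (f : ι → Dual 𝕜 E) :
    ∑ σ ∈ covectors f, (-1 : ℤ) ^ finrank 𝕜 (flat f σ) = (-1) ^ finrank 𝕜 E := by
  refine Finite.induction_empty_option (P := fun ι => ∀ [Finite ι] (f : ι → Dual 𝕜 E),
    ∑ σ ∈ covectors f, (-1 : ℤ) ^ finrank 𝕜 (flat f σ) = (-1) ^ finrank 𝕜 E) ?_ ?_ ?_ ι f
  · intro α β e ih _ f
    have := Finite.of_equiv β e.symm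
    rw [← ih (f ∘ e)]
    refine Finset.sum_equiv (e.arrowCongr (Equiv.refl _)).symm (fun σ => ?_) fun σ _ => ?_
    · rw [mem_covectors, mem_covectors]
      exact exists_congr fun x => (e.arrowCongr (Equiv.refl _)).symm.injective.eq_iff.symm
    · have hflat : flat (f ∘ e) ((e.arrowCongr (Equiv.refl _)).symm σ) = flat f σ := by
        ext v
        simp [mem_flat, e.surjective.forall]
      rw [hflat]
  · intro _ f
    have hcov : covectors f = {isEmptyElim} :=
      Finset.eq_singleton_iff_unique_mem.2
        ⟨mem_covectors.2 ⟨0, Subsingleton.elim _ _⟩, fun _ _ => Subsingleton.elim _ _⟩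
    rw [hcov, Finset.sum_singleton, flat, iInf_of_empty, finrank_top]
  · intro α _ ih _ f
    rw [sum_covectors_option, ← ih (f ∘ some)]
    exact Finset.sum_congr rfl fun σ hσ => sum_signsOnCell_neg_one_pow_finrank f hσ

end EulerRelation

section IsometryDeterminant

open Module

variable {E : Type*} [NormedAddCommGroup E] [InnerProductSpace ℝ E] [FiniteDimensional ℝ E]
  {A : E →ₗ[ℝ] E}

theorem det_adjoint (A : E →ₗ[ℝ] E) : LinearMap.det (LinearMap.adjoint A) = LinearMap.det A := by
  rw [← LinearMap.det_toMatrix (stdOrthonormalBasis ℝ E).toBasis, LinearMap.toMatrix_adjoint,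
    Matrix.det_conjTranspose, LinearMap.det_toMatrix, star_trivial]

/-- For an isometry `A` we have `A* (A - 1) = -(A - 1)*`; now compare determinants. -/
theorem det_of_isometry_of_fixedSubmodule_eq_bot (hA : ∀ x y, inner ℝ (A x) (A y) = inner ℝ x y)
    (hfix : A.fixedSubmodule = ⊥) : LinearMap.det A = (-1) ^ finrank ℝ E := by
  have hne : LinearMap.det (A - 1) ≠ 0 := fun h =>
    (LinearMap.bot_lt_ker_of_det_eq_zero h).ne' (by rwa [LinearMap.fixedSubmodule_eq_ker] at hfix)
  have hinv : LinearMap.adjoint A * A = 1 := by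
    refine LinearMap.ext fun x => ext_inner_right ℝ fun y => ?_
    rw [Module.End.mul_apply, LinearMap.adjoint_inner_left, hA, Module.End.one_apply]
  have hadj : LinearMap.adjoint A * (A - 1) = (-1 : ℝ) • LinearMap.adjoint (A - 1) := by
    rw [mul_sub, hinv, map_sub, LinearMap.adjoint_one, neg_one_smul, neg_sub, mul_one]
  apply mul_right_cancel₀ hne
  rw [← det_adjoint A, ← map_mul, hadj, LinearMap.det_smul, det_adjoint]

theorem det_of_isometry (hA : ∀ x y, inner ℝ (A x) (A y) = inner ℝ x y) :
    LinearMap.det A = (-1) ^ (finrank ℝ E + finrank ℝ A.fixedSubmodule) := by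
  set U := A.fixedSubmodule
  have hmaps : ∀ v ∈ Uᗮ, A v ∈ Uᗮ := fun v hv u hu => by
    rw [← LinearMap.mem_fixedSubmodule_iff.1 hu, hA]
    exact hv u hu
  have hquot : Uᗮ.mapQ Uᗮ A hmaps = LinearMap.id := by
    refine Submodule.linearMap_qext _ (LinearMap.ext fun v => ?_)
    simp only [LinearMap.comp_apply, Submodule.mkQ_apply, Submodule.mapQ_apply, LinearMap.id_apply,
      Submodule.Quotient.eq]
    intro u hu
    rw [inner_sub_right, sub_eq_zero, ← hA u v, LinearMap.mem_fixedSubmodule_iff.1 hu]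
  have hfix : (A.restrict hmaps).fixedSubmodule = ⊥ := (Submodule.eq_bot_iff _).2 fun v hv =>
    Subtype.ext <| inner_self_eq_zero.1 <|
      v.2 v (LinearMap.mem_fixedSubmodule_iff.2 (congrArg Subtype.val hv))
  rw [LinearMap.det_eq_det_mul_det Uᗮ A hmaps, hquot, LinearMap.det_id, mul_one,
    det_of_isometry_of_fixedSubmodule_eq_bot (A := A.restrict hmaps) (fun x y => hA x y) hfix,
    ← U.finrank_add_finrank_orthogonal, add_right_comm, pow_add, Even.neg_one_pow ⟨_, rfl⟩,
    one_mul]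

end IsometryDeterminant

section ReflectionGroup

open RealInnerProductSpace

variable {V : Type*} [NormedAddCommGroup V] [InnerProductSpace ℝ V] {Φ Ψ : Finset V}
  {α β x : V} {g : V ≃ₗ[ℝ] V}

theorem inner_rootReflection_rootReflection (α x y : V) :
    ⟪rootReflection α x, rootReflection α y⟫ = ⟪x, y⟫ :=
  (Submodule.reflection (Submodule.span ℝ {α})ᗮ).inner_map_map x y

theorem rootReflection_self (α : V) : rootReflection α α = -α :=
  Submodule.reflection_orthogonalComplement_singleton_eq_neg α

theorem rootReflection_eq_self (h : ⟪x, α⟫ = 0) : rootReflection α x = x := by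
  rw [rootReflection_apply, inner_smul_right, h, mul_zero, zero_smul, sub_zero]

theorem rootReflection_apply_apply (α x : V) : rootReflection α (rootReflection α x) = x :=
  Submodule.reflection_reflection (Submodule.span ℝ {α})ᗮ x

theorem rootReflection_mul_self (α : V) : rootReflection α * rootReflection α = 1 :=
  LinearEquiv.ext (rootReflection_apply_apply α)

theorem rootReflection_neg (α : V) : rootReflection (-α) = rootReflection α := by
  ext v
  simp [rootReflection_apply]

theorem rootReflection_map (hg : ∀ x y, ⟪g x, g y⟫ = ⟪x, y⟫) (α : V) :
    rootReflection (g α) = g * rootReflection α * g⁻¹ := by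
  refine eq_mul_inv_of_mul_eq (LinearEquiv.ext fun v => ?_)
  simp only [LinearEquiv.mul_apply, rootReflection_apply, map_sub, map_smul, inner_smul_right, hg]

theorem inner_rootReflection_lt (hα : α ≠ 0) (hx : 0 < ⟪x, α⟫) {y : V} (hy : 0 < ⟪y, α⟫) :
    ⟪y, rootReflection α x⟫ < ⟪y, x⟫ := by
  rw [rootReflection_apply, inner_sub_right, inner_smul_right, inner_smul_right]
  have : 0 < ⟪α, α⟫ := real_inner_self_pos.2 hα
  exact sub_lt_self _ (by positivity)

theorem rootReflection_mem_reflectionGroup (hα : α ∈ Φ) : rootReflection α ∈ reflectionGroup Φ :=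
  Subgroup.subset_closure ⟨α, hα, rfl⟩

theorem reflectionGroup_mono (h : Ψ ⊆ Φ) : reflectionGroup Ψ ≤ reflectionGroup Φ :=
  Subgroup.closure_mono (Set.image_mono h)

/-- No case for inverses is needed because reflections are involutions. -/
@[elab_as_elim]
theorem reflectionGroup_induction {p : (g : V ≃ₗ[ℝ] V) → g ∈ reflectionGroup Φ → Prop}
    (one : p 1 (one_mem _))
    (mul : ∀ α (hα : α ∈ Φ) h (hh : h ∈ reflectionGroup Φ), p h hh →
      p (rootReflection α * h) (mul_mem (rootReflection_mem_reflectionGroup hα) hh))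
    (hg : g ∈ reflectionGroup Φ) : p g hg := by
  induction hg using Subgroup.closure_induction_left with
  | one => exact one
  | mul_left s hs h hh ih =>
    obtain ⟨α, hα, rfl⟩ := hs
    exact mul α hα h hh ih
  | inv_mul_cancel s hs h hh ih =>
    obtain ⟨α, hα, rfl⟩ := hs
    simp only [inv_eq_of_mul_eq_one_left (rootReflection_mul_self α)]
    exact mul α hα h hh ih

theorem inner_map_map_of_mem (hg : g ∈ reflectionGroup Φ) : ∀ x y, ⟪g x, g y⟫ = ⟪x, y⟫ := by
  induction hg using reflectionGroup_induction with
  | one => exact fun _ _ => rfl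
  | mul α _ h _ ih =>
    exact fun x y => (inner_rootReflection_rootReflection α (h x) (h y)).trans (ih x y)

theorem inner_map_left (hg : g ∈ reflectionGroup Φ) (x y : V) : ⟪g x, y⟫ = ⟪x, g⁻¹ y⟫ := by
  rw [← inner_map_map_of_mem hg x (g⁻¹ y)]
  exact congrArg _ (g.apply_symm_apply y).symm

theorem map_eq_self_of_mem (hg : g ∈ reflectionGroup Φ) (hx : ∀ α ∈ Φ, ⟪x, α⟫ = 0) : g x = x := by
  induction hg using reflectionGroup_induction with
  | one => rfl
  | mul α hα h _ ih => rw [LinearEquiv.mul_apply, ih, rootReflection_eq_self (hx α hα)]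

theorem IsRootSystem.ne_zero (hΦ : IsRootSystem Φ) (hβ : β ∈ Φ) : β ≠ 0 :=
  ne_of_mem_of_not_mem hβ hΦ.zero_notMem

theorem IsRootSystem.map_mem (hΦ : IsRootSystem Φ) (hg : g ∈ reflectionGroup Φ) (hβ : β ∈ Φ) :
    g β ∈ Φ := by
  induction hg using reflectionGroup_induction with
  | one => exact hβ
  | mul α hα h _ ih => exact hΦ.reflection_mem α hα _ ih

theorem eq_of_eqOn_of_mem (hg : g ∈ reflectionGroup Φ) {h : V ≃ₗ[ℝ] V}
    (hh : h ∈ reflectionGroup Φ) (hgh : ∀ β ∈ Φ, g β = h β) : g = h := by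
  ext v
  obtain ⟨a, ha, b, hb, rfl⟩ := (Submodule.span ℝ (Φ : Set V)).exists_add_mem_mem_orthogonal v
  have hab : g a = h a := LinearMap.eqOn_span (f := (g : V →ₗ[ℝ] V)) (g := (h : V →ₗ[ℝ] V)) hgh ha
  have hbΦ : ∀ α ∈ Φ, ⟪b, α⟫ = 0 := fun α hα =>
    Submodule.inner_left_of_mem_orthogonal (Submodule.subset_span hα) hb
  rw [map_add, map_add, hab, map_eq_self_of_mem hg hbΦ, map_eq_self_of_mem hh hbΦ]

theorem IsRootSystem.finite_reflectionGroup (hΦ : IsRootSystem Φ) :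
    Finite (reflectionGroup Φ) :=
  .of_injective (fun (g : reflectionGroup Φ) (β : Φ) =>
      (⟨(g : V ≃ₗ[ℝ] V) β, hΦ.map_mem g.2 β.2⟩ : Φ)) fun g h hgh =>
    Subtype.ext <| eq_of_eqOn_of_mem g.2 h.2 fun β hβ =>
      congrArg Subtype.val (congrFun hgh ⟨β, hβ⟩)

end ReflectionGroup

section Faces

open RealInnerProductSpace

variable {V : Type*} [NormedAddCommGroup V] [InnerProductSpace ℝ V] {Δ K : Finset V} {x β : V}

/-- The face of type `K` of the closed fundamental chamber `{x | ∀ δ ∈ Δ, 0 ≤ ⟪x, δ⟫}`: its points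
lie on the walls `δᗮ` with `δ ∈ K` and on no other wall. -/
def face (Δ K : Finset V) : Set V :=
  {x | (∀ δ ∈ Δ, 0 ≤ ⟪x, δ⟫) ∧ ∀ δ ∈ Δ, ⟪x, δ⟫ = 0 ↔ δ ∈ K}

theorem exists_mem_face (hx : ∀ δ ∈ Δ, 0 ≤ ⟪x, δ⟫) : ∃ K ⊆ Δ, x ∈ face Δ K := by
  classical
  exact ⟨Δ.filter fun δ => ⟪x, δ⟫ = 0, Δ.filter_subset _, hx, fun δ hδ => by simp [hδ]⟩

theorem exists_inner_eq (hΔ : LinearIndepOn ℝ id (Δ : Set V)) (c : V → ℝ) :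
    ∃ x : V, ∀ δ ∈ Δ, ⟪x, δ⟫ = c δ := by
  let b := Module.Basis.span hΔ
  let p := Submodule.span ℝ (Set.range fun δ : (Δ : Set V) => id δ.1)
  have : FiniteDimensional ℝ p := b.finiteDimensional_of_finite
  refine ⟨(InnerProductSpace.toDual ℝ p).symm
    (LinearMap.toContinuousLinearMap (b.constr ℝ fun δ => c δ)), fun δ hδ => ?_⟩
  have hb : (b ⟨δ, hδ⟩ : V) = δ :=
    congrArg Subtype.val (Module.Basis.span_apply hΔ ⟨δ, hδ⟩)
  conv_lhs => rw [← hb]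
  rw [← Submodule.coe_inner, InnerProductSpace.toDual_symm_apply,
    LinearMap.coe_toContinuousLinearMap', b.constr_basis]

theorem face_nonempty (hΔ : LinearIndepOn ℝ id (Δ : Set V)) (K : Finset V) :
    (face Δ K).Nonempty := by
  classical
  obtain ⟨x, hx⟩ := exists_inner_eq hΔ fun δ => if δ ∈ K then 0 else 1
  refine ⟨x, fun δ hδ => ?_, fun δ hδ => ?_⟩ <;> rw [hx δ hδ] <;> split_ifs <;> simp [*]

theorem inner_pos_of_mem_face_empty (hx : x ∈ face Δ ∅) (hβ : β ∈ Δ) : 0 < ⟪x, β⟫ :=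
  (hx.1 β hβ).lt_of_ne' fun h => Finset.notMem_empty β ((hx.2 β hβ).1 h)

theorem inner_nonneg_of_mem_span (hx : x ∈ face Δ K)
    (hβ : β ∈ Submodule.span ℝ≥0 (Δ : Set V)) : 0 ≤ ⟪x, β⟫ := by
  obtain ⟨c, -, rfl⟩ := Submodule.mem_span_finset.1 hβ
  rw [inner_sum]
  refine Finset.sum_nonneg fun δ hδ => ?_
  rw [NNReal.smul_def, inner_smul_right]
  exact mul_nonneg (c δ).2 (hx.1 δ hδ)

theorem inner_eq_zero_of_mem_span (hK : K ⊆ Δ) (hx : x ∈ face Δ K)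
    (hβ : β ∈ Submodule.span ℝ (K : Set V)) : ⟪x, β⟫ = 0 :=
  Submodule.span_le (p := LinearMap.ker (innerₛₗ ℝ x)).2 (fun δ hδ => (hx.2 δ (hK hδ)).2 hδ) hβ

theorem mem_span_of_inner_eq_zero (hx : x ∈ face Δ K)
    (hβ : β ∈ Submodule.span ℝ≥0 (Δ : Set V)) (h : ⟪x, β⟫ = 0) :
    β ∈ Submodule.span ℝ≥0 (K : Set V) := by
  obtain ⟨c, -, rfl⟩ := Submodule.mem_span_finset.1 hβ
  simp only [inner_sum, NNReal.smul_def, inner_smul_right] at h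
  replace h := (Finset.sum_eq_zero_iff_of_nonneg fun δ hδ => mul_nonneg (c δ).2 (hx.1 δ hδ)).1 h
  refine Submodule.sum_mem _ fun δ hδ => ?_
  rcases mul_eq_zero.1 (h δ hδ) with hc | hδx
  · rw [NNReal.coe_eq_zero.1 hc, zero_smul]
    exact Submodule.zero_mem _
  · exact Submodule.smul_mem _ _ (Submodule.subset_span ((hx.2 δ hδ).1 hδx))

theorem mem_span_nnreal_of_mem_span (hΔ : LinearIndepOn ℝ id (Δ : Set V)) (hK : K ⊆ Δ)
    (hβ : β ∈ Submodule.span ℝ≥0 (Δ : Set V)) (h : β ∈ Submodule.span ℝ (K : Set V)) :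
    β ∈ Submodule.span ℝ≥0 (K : Set V) := by
  obtain ⟨x, hx⟩ := face_nonempty hΔ K
  exact mem_span_of_inner_eq_zero hx hβ (inner_eq_zero_of_mem_span hK hx h)

theorem inner_eq_zero_iff_mem_span (hK : K ⊆ Δ) (hx : x ∈ face Δ K)
    (hβ : β ∈ Submodule.span ℝ≥0 (Δ : Set V)) : ⟪x, β⟫ = 0 ↔ β ∈ Submodule.span ℝ (K : Set V) :=
  ⟨fun h => Submodule.span_le_restrictScalars ℝ≥0 ℝ _ (mem_span_of_inner_eq_zero hx hβ h),
    inner_eq_zero_of_mem_span hK hx⟩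

end Faces

section SimpleSystems

open RealInnerProductSpace Pointwise

variable {V : Type*} [NormedAddCommGroup V] [InnerProductSpace ℝ V] {Φ Δ K L : Finset V}
  {α β x y : V} {g : V ≃ₗ[ℝ] V} {n : ℕ}

theorem IsSimpleSystem.mem_positiveRoots_or_neg_mem (hΔ : IsSimpleSystem Φ Δ) (hβ : β ∈ Φ) :
    β ∈ positiveRoots Φ Δ ∨ -β ∈ positiveRoots Φ Δ :=
  hΔ.eq_union.subset (Finset.mem_coe.2 hβ)

theorem IsSimpleSystem.neg_notMem_positiveRoots (hΔ : IsSimpleSystem Φ Δ)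
    (hβ : β ∈ positiveRoots Φ Δ) : -β ∉ positiveRoots Φ Δ :=
  hΔ.disjoint.notMem_of_mem_left hβ

theorem IsSimpleSystem.mem_positiveRoots (hΔ : IsSimpleSystem Φ Δ) (hα : α ∈ Δ) :
    α ∈ positiveRoots Φ Δ :=
  ⟨hΔ.subset hα, Submodule.subset_span hα⟩

theorem IsSimpleSystem.map_mem (hΦ : IsRootSystem Φ) (hΔ : IsSimpleSystem Φ Δ)
    (hg : g ∈ reflectionGroup Δ) (hβ : β ∈ Φ) : g β ∈ Φ :=
  hΦ.map_mem (reflectionGroup_mono hΔ.subset hg) hβ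

theorem IsSimpleSystem.inner_eq_zero_iff (hΔ : IsSimpleSystem Φ Δ) (hK : K ⊆ Δ)
    (hx : x ∈ face Δ K) (hβ : β ∈ Φ) : ⟪x, β⟫ = 0 ↔ β ∈ Submodule.span ℝ (K : Set V) := by
  rcases hΔ.mem_positiveRoots_or_neg_mem hβ with h | h
  · exact inner_eq_zero_iff_mem_span hK hx h.2
  · rw [← neg_mem_iff, ← inner_eq_zero_iff_mem_span hK hx h.2, inner_neg_right, neg_eq_zero]

theorem IsSimpleSystem.sign_inner_eq (hΔ : IsSimpleSystem Φ Δ) (hK : K ⊆ Δ)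
    (hx : x ∈ face Δ K) (hy : y ∈ face Δ K) (hβ : β ∈ Φ) :
    SignType.sign ⟪x, β⟫ = SignType.sign ⟪y, β⟫ := by
  have sign_eq_of_pos : ∀ γ ∈ positiveRoots Φ Δ,
      SignType.sign ⟪x, γ⟫ = SignType.sign ⟪y, γ⟫ := by
    intro γ hγ
    have hzero : ⟪x, γ⟫ = 0 ↔ ⟪y, γ⟫ = 0 := by
      rw [hΔ.inner_eq_zero_iff hK hx hγ.1, hΔ.inner_eq_zero_iff hK hy hγ.1]
    rcases (inner_nonneg_of_mem_span hx hγ.2).eq_or_lt with h | h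
    · rw [← h, hzero.1 h.symm]
    · rw [sign_pos h, sign_pos ((inner_nonneg_of_mem_span hy hγ.2).lt_of_ne'
        fun h0 => h.ne' (hzero.2 h0))]
  rcases hΔ.mem_positiveRoots_or_neg_mem hβ with h | h
  · exact sign_eq_of_pos β h
  · simpa only [inner_neg_right, Left.sign_neg, neg_inj] using sign_eq_of_pos (-β) h

theorem IsSimpleSystem.eq_of_neg_rootReflection_mem (hΦ : IsRootSystem Φ)
    (hΔ : IsSimpleSystem Φ Δ) (hα : α ∈ Δ) (hβ : β ∈ positiveRoots Φ Δ)
    (hneg : -rootReflection α β ∈ positiveRoots Φ Δ) : β = α := by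
  obtain ⟨x, hx⟩ := face_nonempty hΔ.linearIndepOn {α}
  have hxα : rootReflection α x = x :=
    rootReflection_eq_self ((hx.2 α hα).2 (Finset.mem_singleton_self α))
  have hle : ⟪x, β⟫ ≤ 0 := by
    have h := inner_nonneg_of_mem_span hx hneg.2
    rwa [inner_neg_right, ← hxα, inner_rootReflection_rootReflection, neg_nonneg] at h
  have hspan := mem_span_of_inner_eq_zero hx hβ.2
    (hle.antisymm (inner_nonneg_of_mem_span hx hβ.2))
  rw [Finset.coe_singleton, Submodule.mem_span_singleton] at hspan
  obtain ⟨c, rfl⟩ := hspan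
  rcases hΦ.reduced α (hΔ.subset hα) c hβ.1 with h | h
  · rw [NNReal.smul_def, h, one_smul]
  · exact absurd c.2 (by rw [NNReal.val_eq_coe, h]; norm_num)

theorem IsSimpleSystem.rootReflection_injOn (hΦ : IsRootSystem Φ) (hΔ : IsSimpleSystem Φ Δ) :
    Set.InjOn rootReflection (Δ : Set V) := by
  intro α hα β hβ h
  refine hΔ.eq_of_neg_rootReflection_mem hΦ hβ (hΔ.mem_positiveRoots hα) ?_
  rw [← h, rootReflection_self, neg_neg]
  exact hΔ.mem_positiveRoots hα

theorem pow_rootReflection_subset_reflectionGroup (Δ : Finset V) (n : ℕ) :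
    (rootReflection '' (Δ : Set V)) ^ n ⊆ reflectionGroup Δ := by
  induction n with
  | zero => exact Set.singleton_subset_iff.2 (one_mem _)
  | succ n ih =>
    rw [pow_succ]
    exact Set.mul_subset_iff.2 fun g hg h hh => mul_mem (ih hg) (Subgroup.subset_closure hh)

theorem exists_mem_pow_rootReflection (hg : g ∈ reflectionGroup Δ) :
    ∃ n, g ∈ (rootReflection '' (Δ : Set V)) ^ n := by
  induction hg using reflectionGroup_induction with
  | one => exact ⟨0, Set.one_mem_one⟩
  | mul α hα h _ ih =>
    obtain ⟨n, hn⟩ := ih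
    exact ⟨n + 1, pow_succ' (rootReflection '' (Δ : Set V)) n ▸ Set.mul_mem_mul ⟨α, hα, rfl⟩ hn⟩

theorem IsSimpleSystem.exchange (hΦ : IsRootSystem Φ) (hΔ : IsSimpleSystem Φ Δ) (hα : α ∈ Δ)
    (hg : g ∈ (rootReflection '' (Δ : Set V)) ^ n) (hneg : -g α ∈ positiveRoots Φ Δ) :
    ∃ m < n, g * rootReflection α ∈ (rootReflection '' (Δ : Set V)) ^ m := by
  induction n generalizing g with
  | zero =>
    rw [pow_zero, Set.mem_one] at hg
    exact absurd (by simpa [hg] using hneg) (hΔ.neg_notMem_positiveRoots (hΔ.mem_positiveRoots hα))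
  | succ n ih =>
    rw [pow_succ'] at hg
    obtain ⟨_, ⟨γ, hγ, rfl⟩, h, hh, rfl⟩ := hg
    have hhΔ := pow_rootReflection_subset_reflectionGroup Δ n hh
    rcases hΔ.mem_positiveRoots_or_neg_mem (hΔ.map_mem hΦ hhΔ (hΔ.subset hα)) with hpos | hneg'
    · refine ⟨n, n.lt_succ_self, ?_⟩
      have hγα : h α = γ := hΔ.eq_of_neg_rootReflection_mem hΦ hγ hpos hneg
      suffices rootReflection γ * h * rootReflection α = h by rwa [this]
      rw [← hγα, rootReflection_map (inner_map_map_of_mem hhΔ), inv_mul_cancel_right, mul_assoc,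
        rootReflection_mul_self, mul_one]
    · obtain ⟨m, hm, hmem⟩ := ih hh hneg'
      refine ⟨m + 1, Nat.succ_lt_succ hm, ?_⟩
      rw [pow_succ', mul_assoc]
      exact Set.mul_mem_mul ⟨γ, hγ, rfl⟩ hmem

theorem IsSimpleSystem.exists_descent (hΦ : IsRootSystem Φ) (hΔ : IsSimpleSystem Φ Δ)
    (hg : g ∈ (rootReflection '' (Δ : Set V)) ^ n) (hne : g ≠ 1) :
    ∃ α ∈ Δ, -g α ∈ positiveRoots Φ Δ ∧
      ∃ m < n, g * rootReflection α ∈ (rootReflection '' (Δ : Set V)) ^ m := by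
  induction n using Nat.strong_induction_on with
  | _ n ih =>
    cases n with
    | zero => exact absurd (Set.mem_one.1 (pow_zero (rootReflection '' (Δ : Set V)) ▸ hg)) hne
    | succ n =>
      have hgΔ := pow_rootReflection_subset_reflectionGroup Δ _ hg
      rw [pow_succ] at hg
      obtain ⟨k, hk, _, ⟨α, hα, rfl⟩, rfl⟩ := hg
      rcases hΔ.mem_positiveRoots_or_neg_mem (hΔ.map_mem hΦ hgΔ (hΔ.subset hα)) with hpos | hneg
      · rw [LinearEquiv.mul_apply, rootReflection_self, map_neg] at hpos
        obtain ⟨m, hm, hmem⟩ := hΔ.exchange hΦ hα hk hpos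
        obtain ⟨γ, hγ, hneg, l, hl, hlmem⟩ := ih m (hm.trans n.lt_succ_self) hmem
        exact ⟨γ, hγ, hneg, l, hl.trans (hm.trans n.lt_succ_self), hlmem⟩
      · refine ⟨α, hα, hneg, n, n.lt_succ_self, ?_⟩
        rwa [mul_assoc, rootReflection_mul_self, mul_one]

/-- If `α` is a simple root that `g` makes negative, then `⟪x, α⟫ = 0`: both `x` and `g x` are
dominant. So `g * rootReflection α` also maps `x` to `g x`, and it is a shorter word. -/
theorem IsSimpleSystem.map_eq_self_and_mem (hΦ : IsRootSystem Φ) (hΔ : IsSimpleSystem Φ Δ)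
    (hx : x ∈ face Δ K) (hg : g ∈ reflectionGroup Δ) (hgx : g x ∈ face Δ L) :
    g x = x ∧ g ∈ reflectionGroup K := by
  obtain ⟨n, hn⟩ := exists_mem_pow_rootReflection hg
  induction n using Nat.strong_induction_on generalizing g with
  | _ n ih =>
    rcases eq_or_ne g 1 with rfl | hne
    · exact ⟨rfl, one_mem _⟩
    obtain ⟨α, hα, hneg, m, hm, hmem⟩ := hΔ.exists_descent hΦ hn hne
    have hxα : ⟪x, α⟫ = 0 := by
      have h := inner_nonneg_of_mem_span hgx hneg.2
      rw [inner_neg_right, inner_map_map_of_mem hg, neg_nonneg] at h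
      exact h.antisymm (hx.1 α hα)
    have hgα : (g * rootReflection α) x = g x := congrArg g (rootReflection_eq_self hxα)
    obtain ⟨hfix, hstab⟩ :=
      ih m hm (mul_mem hg (rootReflection_mem_reflectionGroup hα)) (hgα.symm ▸ hgx) hmem
    refine ⟨hgα.symm.trans hfix, ?_⟩
    have := mul_mem hstab (rootReflection_mem_reflectionGroup ((hx.2 α hα).1 hxα))
    rwa [mul_assoc, rootReflection_mul_self, mul_one] at this

theorem IsSimpleSystem.finite_reflectionGroup (hΦ : IsRootSystem Φ) (hΔ : IsSimpleSystem Φ Δ) :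
    Finite (reflectionGroup Δ) :=
  have := hΦ.finite_reflectionGroup
  .of_injective _ (Subgroup.inclusion_injective (reflectionGroup_mono hΔ.subset))

theorem IsSimpleSystem.exists_map_mem_face (hΦ : IsRootSystem Φ) (hΔ : IsSimpleSystem Φ Δ)
    (x : V) : ∃ g ∈ reflectionGroup Δ, ∃ K ⊆ Δ, g x ∈ face Δ K := by
  obtain ⟨ρ, hρ⟩ := face_nonempty hΔ.linearIndepOn ∅
  have := hΔ.finite_reflectionGroup hΦ
  obtain ⟨g, hg⟩ := Finite.exists_max fun g : reflectionGroup Δ => ⟪ρ, (g : V ≃ₗ[ℝ] V) x⟫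
  refine ⟨g, g.2, exists_mem_face fun δ hδ => le_of_not_gt fun hneg => ?_⟩
  let s : reflectionGroup Δ := ⟨rootReflection δ, rootReflection_mem_reflectionGroup hδ⟩
  have hpos : 0 < ⟪rootReflection δ ((g : V ≃ₗ[ℝ] V) x), δ⟫ := by
    rwa [← inner_rootReflection_rootReflection δ, rootReflection_apply_apply, rootReflection_self,
      inner_neg_right, neg_pos]
  have hlt := inner_rootReflection_lt (hΦ.ne_zero (hΔ.subset hδ)) hpos
    (inner_pos_of_mem_face_empty hρ hδ)
  rw [rootReflection_apply_apply] at hlt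
  exact hlt.not_ge (hg (s * g))

theorem exists_inner_pos_of_mem_span (hβ : β ∈ Submodule.span ℝ≥0 (Δ : Set V)) (h0 : β ≠ 0) :
    ∃ δ ∈ Δ, 0 < ⟪β, δ⟫ := by
  by_contra! h
  obtain ⟨K, -, hK⟩ := exists_mem_face (Δ := Δ) (x := -β) fun δ hδ => by
    rw [inner_neg_left, neg_nonneg]
    exact h δ hδ
  have := inner_nonneg_of_mem_span hK hβ
  rw [inner_neg_left, neg_nonneg] at this
  exact this.not_gt (real_inner_self_pos.2 h0)

theorem IsSimpleSystem.exists_map_mem (hΦ : IsRootSystem Φ) (hΔ : IsSimpleSystem Φ Δ)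
    (hβ : β ∈ positiveRoots Φ Δ) : ∃ g ∈ reflectionGroup Δ, g β ∈ Δ := by
  obtain ⟨ρ, hρ⟩ := face_nonempty hΔ.linearIndepOn ∅
  obtain ⟨γ, ⟨hγ, g, hg, rfl⟩, hmin⟩ := Set.exists_min_image
    {γ ∈ positiveRoots Φ Δ | ∃ g ∈ reflectionGroup Δ, g β = γ} (fun γ => ⟪ρ, γ⟫)
    (Φ.finite_toSet.subset fun γ hγ => hγ.1.1) ⟨β, hβ, 1, one_mem _, rfl⟩
  obtain ⟨δ, hδ, hpos⟩ := exists_inner_pos_of_mem_span hγ.2 (hΦ.ne_zero hγ.1)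
  refine ⟨g, hg, ?_⟩
  rcases hΔ.mem_positiveRoots_or_neg_mem (hΦ.reflection_mem δ (hΔ.subset hδ) _ hγ.1) with h | h
  · exact absurd (inner_rootReflection_lt (hΦ.ne_zero (hΔ.subset hδ)) hpos
        (inner_pos_of_mem_face_empty hρ hδ))
      (hmin _ ⟨h, _, mul_mem (rootReflection_mem_reflectionGroup hδ) hg, rfl⟩).not_gt
  · rwa [hΔ.eq_of_neg_rootReflection_mem hΦ hδ hγ h]

theorem IsSimpleSystem.reflectionGroup_eq (hΦ : IsRootSystem Φ) (hΔ : IsSimpleSystem Φ Δ) :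
    reflectionGroup Δ = reflectionGroup Φ := by
  have hpos : ∀ β ∈ positiveRoots Φ Δ, rootReflection β ∈ reflectionGroup Δ := by
    intro β hβ
    obtain ⟨g, hg, hgβ⟩ := hΔ.exists_map_mem hΦ hβ
    have hconj := rootReflection_mem_reflectionGroup hgβ
    rw [rootReflection_map (inner_map_map_of_mem hg)] at hconj
    rwa [Subgroup.mul_mem_cancel_right _ (inv_mem hg), Subgroup.mul_mem_cancel_left _ hg] at hconj
  refine le_antisymm (reflectionGroup_mono hΔ.subset) ((Subgroup.closure_le _).2 ?_)
  rintro _ ⟨β, hβ, rfl⟩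
  rcases hΔ.mem_positiveRoots_or_neg_mem hβ with h | h
  · exact hpos β h
  · exact rootReflection_neg β ▸ hpos (-β) h

end SimpleSystems

section SolomonFormula

open Module RealInnerProductSpace

variable {V : Type*} [NormedAddCommGroup V] [InnerProductSpace ℝ V] {Φ Δ K L : Finset V}
  {x y v : V} {g h w : V ≃ₗ[ℝ] V} {σ : Φ → SignType}

/-- The linear forms `x ↦ ⟪x, β⟫` for `β ∈ Φ`, which define the reflection arrangement of `Φ`. -/
def rootForms (Φ : Finset V) (β : Φ) : Dual ℝ V :=
  innerₛₗ ℝ (β : V)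

theorem signVector_rootForms_eq_iff :
    signVector (rootForms Φ) x = signVector (rootForms Φ) y ↔
      ∀ β ∈ Φ, SignType.sign ⟪x, β⟫ = SignType.sign ⟪y, β⟫ := by
  simp only [funext_iff, signVector, rootForms, innerₛₗ_apply_apply, real_inner_comm,
    Subtype.forall]

theorem mem_flat_rootForms :
    v ∈ flat (rootForms Φ) (signVector (rootForms Φ) x) ↔ ∀ β ∈ Φ, ⟪x, β⟫ = 0 → ⟪v, β⟫ = 0 := by
  simp only [mem_flat_signVector, rootForms, innerₛₗ_apply_apply, real_inner_comm, Subtype.forall]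

theorem IsRootSystem.signVector_map_eq_iff (hΦ : IsRootSystem Φ) (hg : g ∈ reflectionGroup Φ) :
    signVector (rootForms Φ) (g x) = signVector (rootForms Φ) (g y) ↔
      signVector (rootForms Φ) x = signVector (rootForms Φ) y := by
  simp only [signVector_rootForms_eq_iff]
  refine ⟨fun hxy β hβ => ?_, fun hxy β hβ => ?_⟩
  · simpa only [inner_map_map_of_mem hg] using hxy (g β) (hΦ.map_mem hg hβ)
  · simpa only [inner_map_left hg] using hxy (g⁻¹ β) (hΦ.map_mem (inv_mem hg) hβ)

theorem mem_face_of_signVector_eq (hΔ : Δ ⊆ Φ) (hx : x ∈ face Δ K)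
    (hxy : signVector (rootForms Φ) y = signVector (rootForms Φ) x) : y ∈ face Δ K := by
  rw [signVector_rootForms_eq_iff] at hxy
  refine ⟨fun δ hδ => ?_, fun δ hδ => ?_⟩
  · rw [← sign_nonneg_iff, hxy δ (hΔ hδ), sign_nonneg_iff]
    exact hx.1 δ hδ
  · rw [← sign_eq_zero_iff, hxy δ (hΔ hδ), sign_eq_zero_iff]
    exact hx.2 δ hδ

theorem eq_of_mem_face (hK : K ⊆ Δ) (hL : L ⊆ Δ) (hxK : x ∈ face Δ K) (hxL : x ∈ face Δ L) :
    K = L := by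
  ext δ
  exact ⟨fun h => (hxL.2 δ (hK h)).1 ((hxK.2 δ (hK h)).2 h),
    fun h => (hxK.2 δ (hL h)).1 ((hxL.2 δ (hL h)).2 h)⟩

theorem map_eq_self_of_mem_face (hK : K ⊆ Δ) (hx : x ∈ face Δ K) (hg : g ∈ reflectionGroup K) :
    g x = x :=
  map_eq_self_of_mem hg fun α hα => (hx.2 α (hK hα)).2 hα

/-- Hence the cells of type `K` correspond to the cosets of `W_K`. -/
theorem IsSimpleSystem.signVector_map_eq_iff (hΦ : IsRootSystem Φ) (hΔ : IsSimpleSystem Φ Δ)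
    (hK : K ⊆ Δ) (hL : L ⊆ Δ) (hx : x ∈ face Δ K) (hy : y ∈ face Δ L)
    (hg : g ∈ reflectionGroup Δ) (hh : h ∈ reflectionGroup Δ) :
    signVector (rootForms Φ) (g x) = signVector (rootForms Φ) (h y) ↔
      K = L ∧ h⁻¹ * g ∈ reflectionGroup K := by
  have hgx : g x = h ((h⁻¹ * g) x) := (h.apply_symm_apply (g x)).symm
  rw [hgx, hΦ.signVector_map_eq_iff (reflectionGroup_mono hΔ.subset hh)]
  constructor
  · intro hxy
    have hface := mem_face_of_signVector_eq hΔ.subset hy hxy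
    obtain ⟨hfix, hmem⟩ := hΔ.map_eq_self_and_mem hΦ hx (mul_mem (inv_mem hh) hg) hface
    exact ⟨eq_of_mem_face hK hL hx (hfix ▸ hface), hmem⟩
  · rintro ⟨rfl, hmem⟩
    rw [map_eq_self_of_mem_face hK hx hmem]
    exact signVector_rootForms_eq_iff.2 fun β => hΔ.sign_inner_eq hK hx hy

theorem IsSimpleSystem.flat_signVector (hΔ : IsSimpleSystem Φ Δ) (hK : K ⊆ Δ)
    (hx : x ∈ face Δ K) :
    flat (rootForms Φ) (signVector (rootForms Φ) x) = (Submodule.span ℝ (K : Set V))ᗮ := by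
  ext v
  rw [mem_flat_rootForms, Submodule.mem_orthogonal']
  refine ⟨fun hv => ?_, fun hv β hβ hxβ => hv β ((hΔ.inner_eq_zero_iff hK hx hβ).1 hxβ)⟩
  have hle : Submodule.span ℝ (K : Set V) ≤ LinearMap.ker (innerₛₗ ℝ v) :=
    Submodule.span_le.2 fun α hα =>
      hv α (hΔ.subset (hK hα)) ((hx.2 α (hK hα)).2 hα)
  exact fun u hu => hle hu

theorem IsRootSystem.flat_signVector_map (hΦ : IsRootSystem Φ) (hg : g ∈ reflectionGroup Φ)
    (x : V) : flat (rootForms Φ) (signVector (rootForms Φ) (g x)) =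
      (flat (rootForms Φ) (signVector (rootForms Φ) x)).map (g : V →ₗ[ℝ] V) := by
  ext v
  obtain ⟨u, rfl⟩ := g.surjective v
  rw [Submodule.mem_map_equiv, g.symm_apply_apply, mem_flat_rootForms, mem_flat_rootForms]
  refine ⟨fun hu β hβ => ?_, fun hu β hβ => ?_⟩
  · simpa only [inner_map_map_of_mem hg] using hu (g β) (hΦ.map_mem hg hβ)
  · simpa only [inner_map_left hg] using hu (g⁻¹ β) (hΦ.map_mem (inv_mem hg) hβ)

theorem IsSimpleSystem.map_eq_self_of_mem_flat (hΦ : IsRootSystem Φ) (hΔ : IsSimpleSystem Φ Δ)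
    (hK : K ⊆ Δ) (hx : x ∈ face Δ K) (hg : g ∈ reflectionGroup Δ)
    (hw : g⁻¹ * w * g ∈ reflectionGroup K)
    (hv : v ∈ flat (rootForms Φ) (signVector (rootForms Φ) (g x))) : w v = v := by
  rw [hΦ.flat_signVector_map (reflectionGroup_mono hΔ.subset hg), hΔ.flat_signVector hK hx] at hv
  obtain ⟨u, hu, rfl⟩ := hv
  have hfix : (g⁻¹ * w * g) u = u := map_eq_self_of_mem hw fun α hα =>
    Submodule.inner_left_of_mem_orthogonal (Submodule.subset_span hα) hu
  have hwg : w * g = g * (g⁻¹ * w * g) := by group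
  exact (LinearEquiv.congr_fun hwg u).trans (congrArg g hfix)

open Classical in
/-- The cells of the reflection arrangement of `Φ` which meet the fixed space of `w` and are
translates of the face of type `K`, given by their sign vectors. -/
def fixedCovectors (Φ Δ : Finset V) (w : V ≃ₗ[ℝ] V) (K : Finset V) : Finset (Φ → SignType) :=
  (covectors fun β => (rootForms Φ β).domRestrict (w : V →ₗ[ℝ] V).fixedSubmodule).filter
    fun σ => ∃ g ∈ reflectionGroup Δ, ∃ x ∈ face Δ K, signVector (rootForms Φ) (g x) = σ

theorem mem_fixedCovectors : σ ∈ fixedCovectors Φ Δ w K ↔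
    σ ∈ covectors (fun β => (rootForms Φ β).domRestrict (w : V →ₗ[ℝ] V).fixedSubmodule) ∧
      ∃ g ∈ reflectionGroup Δ, ∃ x ∈ face Δ K, signVector (rootForms Φ) (g x) = σ := by
  classical
  exact Finset.mem_filter

theorem IsSimpleSystem.mem_fixedCovectors_iff (hΦ : IsRootSystem Φ) (hΔ : IsSimpleSystem Φ Δ)
    (hK : K ⊆ Δ) (hw : w ∈ reflectionGroup Δ) :
    σ ∈ fixedCovectors Φ Δ w K ↔ ∃ g ∈ reflectionGroup Δ, g⁻¹ * w * g ∈ reflectionGroup K ∧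
      ∃ x ∈ face Δ K, signVector (rootForms Φ) (g x) = σ := by
  rw [mem_fixedCovectors, mem_covectors]
  constructor
  · rintro ⟨⟨u, rfl⟩, g, hg, x, hx, hgx⟩
    have hu : w u = u := LinearMap.mem_fixedSubmodule_iff.1 u.2
    refine ⟨g, hg, ?_, x, hx, hgx⟩
    have hface : g⁻¹ (u : V) ∈ face Δ K := by
      refine mem_face_of_signVector_eq hΔ.subset hx ?_
      rw [← hΦ.signVector_map_eq_iff (reflectionGroup_mono hΔ.subset hg), hgx]
      exact congrArg _ (g.apply_symm_apply (u : V))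
    have hfix : (g⁻¹ * w * g) (g⁻¹ (u : V)) = g⁻¹ (u : V) := by
      rw [← LinearEquiv.mul_apply, mul_inv_cancel_right, LinearEquiv.mul_apply, hu]
    exact (hΔ.map_eq_self_and_mem hΦ hface (mul_mem (mul_mem (inv_mem hg) hw) hg)
      (hfix.symm ▸ hface)).2
  · rintro ⟨g, hg, hgw, x, hx, rfl⟩
    have hfix : w (g x) = g x :=
      hΔ.map_eq_self_of_mem_flat hΦ hK hx hg hgw (mem_flat_rootForms.2 fun _ _ => id)
    exact ⟨⟨⟨g x, LinearMap.mem_fixedSubmodule_iff.2 hfix⟩, rfl⟩, g, hg, x, hx, rfl⟩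

theorem IsSimpleSystem.inducedFunction_one_eq_card_fixedCovectors (hΦ : IsRootSystem Φ)
    (hΔ : IsSimpleSystem Φ Δ) (hK : K ⊆ Δ) (hw : w ∈ reflectionGroup Δ) :
    inducedFunction (reflectionGroup Δ) (reflectionGroup K) (1 : (V ≃ₗ[ℝ] V) → ℝ) w =
      (fixedCovectors Φ Δ w K).card := by
  obtain ⟨x, hx⟩ := face_nonempty hΔ.linearIndepOn K
  have := hΔ.finite_reflectionGroup hΦ
  have hcoset : ∀ g ∈ reflectionGroup Δ, ∀ h ∈ reflectionGroup Δ,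
      signVector (rootForms Φ) (g x) = signVector (rootForms Φ) (h x) ↔
        h⁻¹ * g ∈ reflectionGroup K := fun g hg h hh => by
    rw [hΔ.signVector_map_eq_iff hΦ hK hK hx hx hg hh, and_iff_right rfl]
  have himage : (fun g : V ≃ₗ[ℝ] V => signVector (rootForms Φ) (g x)) ''
      {g | g ∈ reflectionGroup Δ ∧ g⁻¹ * w * g ∈ reflectionGroup K} =
      fixedCovectors Φ Δ w K := by
    ext σ
    rw [Finset.mem_coe, hΔ.mem_fixedCovectors_iff hΦ hK hw]
    constructor
    · rintro ⟨g, ⟨hg, hgw⟩, rfl⟩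
      exact ⟨g, hg, hgw, x, hx, rfl⟩
    · rintro ⟨g, hg, hgw, y, hy, rfl⟩
      exact ⟨g, ⟨hg, hgw⟩,
        (hΔ.signVector_map_eq_iff hΦ hK hK hx hy hg hg).2 ⟨rfl, by simp [one_mem]⟩⟩
  rw [inducedFunction_one_eq_card_image (reflectionGroup_mono hK) hcoset, himage,
    Nat.card_eq_card_toFinset, Finset.toFinset_coe]

theorem IsSimpleSystem.pairwiseDisjoint_fixedCovectors (hΦ : IsRootSystem Φ)
    (hΔ : IsSimpleSystem Φ Δ) (w : V ≃ₗ[ℝ] V) :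
    (Δ.powerset : Set (Finset V)).PairwiseDisjoint (fixedCovectors Φ Δ w) := by
  intro K hK L hL hne
  refine Finset.disjoint_left.2 fun σ hσK hσL => hne ?_
  obtain ⟨g, hg, x, hx, rfl⟩ := (mem_fixedCovectors.1 hσK).2
  obtain ⟨h, hh, y, hy, hxy⟩ := (mem_fixedCovectors.1 hσL).2
  exact ((hΔ.signVector_map_eq_iff hΦ (Finset.mem_powerset.1 hK) (Finset.mem_powerset.1 hL)
    hx hy hg hh).1 hxy.symm).1

theorem IsSimpleSystem.biUnion_fixedCovectors [DecidableEq (Φ → SignType)] (hΦ : IsRootSystem Φ)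
    (hΔ : IsSimpleSystem Φ Δ) (w : V ≃ₗ[ℝ] V) :
    Δ.powerset.biUnion (fixedCovectors Φ Δ w) =
      covectors fun β => (rootForms Φ β).domRestrict (w : V →ₗ[ℝ] V).fixedSubmodule := by
  refine (Finset.biUnion_subset.2 fun K _ σ hσ => (mem_fixedCovectors.1 hσ).1).antisymm ?_
  intro σ hσ
  obtain ⟨u, rfl⟩ := mem_covectors.1 hσ
  obtain ⟨g, hg, K, hK, hgu⟩ := hΔ.exists_map_mem_face hΦ (u : V)
  refine Finset.mem_biUnion.2 ⟨K, Finset.mem_powerset.2 hK, mem_fixedCovectors.2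
    ⟨hσ, g⁻¹, inv_mem hg, g u, hgu, ?_⟩⟩
  exact congrArg (signVector (rootForms Φ)) (g.symm_apply_apply (u : V))

theorem IsSimpleSystem.card_add_finrank_flat [FiniteDimensional ℝ V] (hΦ : IsRootSystem Φ)
    (hΔ : IsSimpleSystem Φ Δ) (hK : K ⊆ Δ) (hw : w ∈ reflectionGroup Δ)
    (hσ : σ ∈ fixedCovectors Φ Δ w K) :
    K.card + finrank ℝ (flat
      (fun β => (rootForms Φ β).domRestrict (w : V →ₗ[ℝ] V).fixedSubmodule) σ) =
      finrank ℝ V := by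
  obtain ⟨g, hg, hgw, x, hx, rfl⟩ := (hΔ.mem_fixedCovectors_iff hΦ hK hw).1 hσ
  have hle : flat (rootForms Φ) (signVector (rootForms Φ) (g x)) ≤
      (w : V →ₗ[ℝ] V).fixedSubmodule := fun v hv =>
    LinearMap.mem_fixedSubmodule_iff.2 (hΔ.map_eq_self_of_mem_flat hΦ hK hx hg hgw hv)
  have hKcard : finrank ℝ (Submodule.span ℝ (K : Set V)) = K.card :=
    finrank_span_finset_eq_card (hΔ.linearIndepOn.mono hK)
  rw [flat_domRestrict, (Submodule.comapSubtypeEquivOfLe hle).finrank_eq,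
    hΦ.flat_signVector_map (reflectionGroup_mono hΔ.subset hg), LinearEquiv.finrank_map_eq,
    hΔ.flat_signVector hK hx, ← hKcard, Submodule.finrank_add_finrank_orthogonal]

theorem IsSimpleSystem.sum_neg_one_pow_card_mul_inducedFunction_one [FiniteDimensional ℝ V]
    (hΦ : IsRootSystem Φ) (hΔ : IsSimpleSystem Φ Δ) (hw : w ∈ reflectionGroup Δ) :
    ∑ K ∈ Δ.powerset, (-1 : ℝ) ^ K.card *
        inducedFunction (reflectionGroup Δ) (reflectionGroup K) 1 w =
      LinearMap.det (w : V →ₗ[ℝ] V) := by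
  classical
  set U := (w : V →ₗ[ℝ] V).fixedSubmodule
  have hsign : ∀ K ∈ Δ.powerset, ∀ σ ∈ fixedCovectors Φ Δ w K, (-1 : ℝ) ^ K.card =
      (-1) ^ finrank ℝ V *
        (-1) ^ finrank ℝ (flat (fun β => (rootForms Φ β).domRestrict U) σ) := by
    intro K hK σ hσ
    rw [← hΔ.card_add_finrank_flat hΦ (Finset.mem_powerset.1 hK) hw hσ, pow_add, mul_assoc,
      ← mul_pow, neg_one_mul, neg_neg, one_pow, mul_one]
  have heuler := congrArg (Int.cast (R := ℝ))
    (sum_covectors_neg_one_pow_finrank fun β => (rootForms Φ β).domRestrict U)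
  push_cast at heuler
  calc
    _ = ∑ K ∈ Δ.powerset, ∑ _ ∈ fixedCovectors Φ Δ w K, (-1 : ℝ) ^ K.card := by
      refine Finset.sum_congr rfl fun K hK => ?_
      rw [hΔ.inducedFunction_one_eq_card_fixedCovectors hΦ (Finset.mem_powerset.1 hK) hw,
        Finset.sum_const, nsmul_eq_mul, mul_comm]
    _ = (-1) ^ finrank ℝ V * ∑ σ ∈ covectors fun β => (rootForms Φ β).domRestrict U,
        (-1 : ℝ) ^ finrank ℝ (flat (fun β => (rootForms Φ β).domRestrict U) σ) := by
      rw [← hΔ.biUnion_fixedCovectors hΦ w,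
        Finset.sum_biUnion (hΔ.pairwiseDisjoint_fixedCovectors hΦ w), Finset.mul_sum]
      refine Finset.sum_congr rfl fun K hK => ?_
      rw [Finset.mul_sum]
      exact Finset.sum_congr rfl (hsign K hK)
    _ = LinearMap.det (w : V →ₗ[ℝ] V) := by
      rw [heuler, ← pow_add, det_of_isometry (inner_map_map_of_mem hw)]

end SolomonFormula

section Parabolic

variable {V : Type*} [NormedAddCommGroup V] [InnerProductSpace ℝ V] {Φ Δ J K : Finset V}

theorem IsRootSystem.filter_mem (hΦ : IsRootSystem Φ) (p : Submodule ℝ V)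
    [DecidablePred (· ∈ p)] : IsRootSystem (Φ.filter (· ∈ p)) where
  zero_notMem h := hΦ.zero_notMem (Finset.mem_filter.1 h).1
  reflection_mem α hα β hβ := by
    obtain ⟨hα, hαp⟩ := Finset.mem_filter.1 hα
    obtain ⟨hβ, hβp⟩ := Finset.mem_filter.1 hβ
    refine Finset.mem_filter.2 ⟨hΦ.reflection_mem α hα β hβ, ?_⟩
    rw [rootReflection_apply]
    exact p.sub_mem hβp (p.smul_mem _ hαp)
  reduced α hα c hc := hΦ.reduced α (Finset.mem_filter.1 hα).1 c (Finset.mem_filter.1 hc).1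

theorem IsSimpleSystem.positiveRoots_filter_mem_span (hΔ : IsSimpleSystem Φ Δ) (hJ : J ⊆ Δ)
    [DecidablePred (· ∈ Submodule.span ℝ (J : Set V))] :
    positiveRoots (Φ.filter (· ∈ Submodule.span ℝ (J : Set V))) J =
      positiveRoots Φ Δ ∩ Submodule.span ℝ (J : Set V) := by
  ext β
  simp only [positiveRoots, Finset.coe_filter, Set.mem_inter_iff, Set.mem_ofPred_eq,
    SetLike.mem_coe]
  constructor
  · rintro ⟨⟨hβ, hβJ⟩, hpos⟩
    exact ⟨⟨hβ, Submodule.span_mono hJ hpos⟩, hβJ⟩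
  · rintro ⟨⟨hβ, hpos⟩, hβJ⟩
    exact ⟨⟨hβ, hβJ⟩, mem_span_nnreal_of_mem_span hΔ.linearIndepOn hJ hpos hβJ⟩

theorem IsSimpleSystem.filter_mem_span (hΔ : IsSimpleSystem Φ Δ) (hJ : J ⊆ Δ)
    [DecidablePred (· ∈ Submodule.span ℝ (J : Set V))] :
    IsSimpleSystem (Φ.filter (· ∈ Submodule.span ℝ (J : Set V))) J where
  subset α hα := Finset.mem_filter.2 ⟨hΔ.subset (hJ hα), Submodule.subset_span hα⟩
  linearIndepOn := hΔ.linearIndepOn.mono hJ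
  eq_union := by
    rw [hΔ.positiveRoots_filter_mem_span hJ, Set.inter_neg, Submodule.neg_coe,
      ← Set.union_inter_distrib_right, ← hΔ.eq_union, Finset.coe_filter]
    rfl
  disjoint := by
    rw [hΔ.positiveRoots_filter_mem_span hJ, Set.inter_neg]
    exact hΔ.disjoint.mono Set.inter_subset_left Set.inter_subset_left

theorem IsSimpleSystem.sum_inducedFunction_one_eq_det_mul [FiniteDimensional ℝ V]
    (hΦ : IsRootSystem Φ) (hΔ : IsSimpleSystem Φ Δ) (hJ : J ⊆ Δ) (w : V ≃ₗ[ℝ] V) :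
    ∑ K ∈ J.powerset, (-1 : ℝ) ^ K.card *
        inducedFunction (reflectionGroup Φ) (reflectionGroup K) 1 w =
      LinearMap.det (w : V →ₗ[ℝ] V) *
        inducedFunction (reflectionGroup Φ) (reflectionGroup J) 1 w := by
  classical
  have := hΦ.finite_reflectionGroup
  have hconj (x w : V ≃ₗ[ℝ] V) : LinearMap.det ((x⁻¹ * w * x : V ≃ₗ[ℝ] V) : V →ₗ[ℝ] V) =
      LinearMap.det (w : V →ₗ[ℝ] V) := LinearMap.det_conj (w : V →ₗ[ℝ] V) x⁻¹
  refine sum_inducedFunction_one_of_eqOn (d := fun w : V ≃ₗ[ℝ] V => LinearMap.det (w : V →ₗ[ℝ] V))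
    (reflectionGroup_mono (hJ.trans hΔ.subset))
    (fun K hK => reflectionGroup_mono (Finset.mem_powerset.1 hK)) hconj (fun w hw => ?_) w
  exact (hΔ.filter_mem_span hJ).sum_neg_one_pow_card_mul_inducedFunction_one (hΦ.filter_mem _) hw

theorem image_val_simpleReflections (hJ : J ⊆ Φ) :
    Subtype.val '' (simpleReflections Φ J : Set (reflectionGroup Φ)) =
      rootReflection '' (J : Set V) := by
  ext w
  constructor
  · rintro ⟨s, hs, rfl⟩
    exact mem_simpleReflections.1 hs
  · rintro ⟨α, hα, rfl⟩
    exact ⟨⟨rootReflection α, rootReflection_mem_reflectionGroup (hJ hα)⟩,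
      mem_simpleReflections.2 ⟨α, hα, rfl⟩, rfl⟩

theorem card_simpleReflections (hJ : J ⊆ Φ) (hinj : Set.InjOn rootReflection (J : Set V)) :
    (simpleReflections Φ J).card = J.card := by
  rw [← Set.ncard_coe_finset, ← Set.ncard_image_of_injective _ Subtype.val_injective,
    image_val_simpleReflections hJ, hinj.ncard_image, Set.ncard_coe_finset]

theorem simpleReflections_injOn (hJ : J ⊆ Φ) (hinj : Set.InjOn rootReflection (J : Set V)) :
    Set.InjOn (simpleReflections Φ) (J.powerset : Set (Finset V)) := by
  intro K hK L hL h
  have hK := Finset.mem_powerset.1 hK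
  have hL := Finset.mem_powerset.1 hL
  rw [← Finset.coe_inj, ← hinj.image_eq_image_iff hK hL,
    ← image_val_simpleReflections (hK.trans hJ), h, image_val_simpleReflections (hL.trans hJ)]

theorem exists_simpleReflections_eq {I : Finset (reflectionGroup Φ)}
    (hI : I ⊆ simpleReflections Φ J) : ∃ K ⊆ J, simpleReflections Φ K = I := by
  classical
  refine ⟨J.filter fun α => ∃ s ∈ I, rootReflection α = (s : V ≃ₗ[ℝ] V),
    Finset.filter_subset _ _, ?_⟩
  ext s
  simp only [mem_simpleReflections, Finset.mem_filter]
  constructor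
  · rintro ⟨α, ⟨-, t, ht, hαt⟩, hαs⟩
    rwa [Subtype.ext (hαs.symm.trans hαt)]
  · intro hs
    obtain ⟨α, hα, hαs⟩ := mem_simpleReflections.1 (hI hs)
    exact ⟨α, ⟨hα, s, hs, hαs⟩, hαs⟩

theorem simpleReflections_mono (hK : K ⊆ J) :
    simpleReflections Φ K ⊆ simpleReflections Φ J := fun _ hs =>
  have ⟨α, hα, hαs⟩ := mem_simpleReflections.1 hs
  mem_simpleReflections.2 ⟨α, hK hα, hαs⟩

theorem sum_powerset_simpleReflections {M : Type*} [AddCommMonoid M] (hJ : J ⊆ Φ)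
    (hinj : Set.InjOn rootReflection (J : Set V)) (f : Finset (reflectionGroup Φ) → M) :
    ∑ I ∈ (simpleReflections Φ J).powerset, f I =
      ∑ K ∈ J.powerset, f (simpleReflections Φ K) := by
  refine (Finset.sum_nbij (simpleReflections Φ) (fun K hK => ?_)
    (simpleReflections_injOn hJ hinj) (fun I hI => ?_) fun _ _ => rfl).symm
  · exact Finset.mem_powerset.2 (simpleReflections_mono (Finset.mem_powerset.1 hK))
  · obtain ⟨K, hK, rfl⟩ := exists_simpleReflections_eq (Finset.mem_powerset.1 hI)
    exact ⟨K, Finset.mem_powerset.2 hK, rfl⟩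

theorem inducedTrivialCharacter_parabolic (hΦ : IsRootSystem Φ) (hJ : J ⊆ Φ)
    (w : reflectionGroup Φ) :
    inducedTrivialCharacter (parabolic (simpleReflections Φ J)) w =
      inducedFunction (reflectionGroup Φ) (reflectionGroup J) 1 (w : V ≃ₗ[ℝ] V) := by
  have := hΦ.finite_reflectionGroup
  have hmap : (parabolic (simpleReflections Φ J)).map (reflectionGroup Φ).subtype =
      reflectionGroup J := by
    rw [parabolic, MonoidHom.map_closure, Subgroup.coe_subtype, image_val_simpleReflections hJ,
      reflectionGroup]
  rw [inducedTrivialCharacter_eq_inducedFunction, hmap]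

theorem IsSimpleSystem.inducedTrivialCharacter_parabolic_simpleReflections
    (hΦ : IsRootSystem Φ) (hΔ : IsSimpleSystem Φ Δ) (w : reflectionGroup Φ) :
    inducedTrivialCharacter (parabolic (simpleReflections Φ Δ)) w = 1 := by
  have := hΦ.finite_reflectionGroup
  rw [inducedTrivialCharacter_parabolic hΦ hΔ.subset, hΔ.reflectionGroup_eq hΦ]
  exact inducedFunction_self (fun _ _ _ => rfl) w.2

theorem IsSimpleSystem.sum_inducedTrivialCharacter_parabolic [FiniteDimensional ℝ V]
    (hΦ : IsRootSystem Φ) (hΔ : IsSimpleSystem Φ Δ) (w : reflectionGroup Φ)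
    {I : Finset (reflectionGroup Φ)} (hI : I ⊆ simpleReflections Φ Δ) :
    ∑ K ∈ I.powerset, (-1 : ℝ) ^ K.card * inducedTrivialCharacter (parabolic K) w =
      LinearMap.det ((w : V ≃ₗ[ℝ] V) : V →ₗ[ℝ] V) * inducedTrivialCharacter (parabolic I) w := by
  obtain ⟨J, hJ, rfl⟩ := exists_simpleReflections_eq hI
  have hinj : Set.InjOn rootReflection (J : Set V) := (hΔ.rootReflection_injOn hΦ).mono hJ
  have hJΦ : J ⊆ Φ := hJ.trans hΔ.subset
  rw [sum_powerset_simpleReflections hJΦ hinj, inducedTrivialCharacter_parabolic hΦ hJΦ,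
    ← hΔ.sum_inducedFunction_one_eq_det_mul hΦ hJ]
  refine Finset.sum_congr rfl fun K hK => ?_
  have hKJ : K ⊆ J := Finset.mem_powerset.1 hK
  rw [card_simpleReflections (hKJ.trans hJΦ) (hinj.mono hKJ),
    inducedTrivialCharacter_parabolic hΦ (hKJ.trans hJΦ)]

end Parabolic

theorem chains_eq_decreasingSequences {V : Type*} [NormedAddCommGroup V] [InnerProductSpace ℝ V]
    (Φ Δ : Finset V) (n : ℕ) :
    chains Φ Δ n = decreasingSequences (simpleReflections Φ Δ) n := by
  ext I
  rw [mem_chains, mem_decreasingSequences]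

theorem det_compLeft {R M ι : Type*} [CommRing R] [AddCommGroup M] [Module R M] [Module.Free R M]
    [Module.Finite R M] [Fintype ι] (f : M →ₗ[R] M) :
    LinearMap.det (f.compLeft ι) = LinearMap.det f ^ Fintype.card ι := by
  classical
  have h : f.compLeft ι = LinearMap.pi fun i => f ∘ₗ LinearMap.proj i := rfl
  rw [h, LinearMap.det_pi, Finset.prod_const, Finset.card_univ]

end

end EuclideanRoots

theorem mainTheorem6 {V : Type*} [NormedAddCommGroup V] [InnerProductSpace ℝ V]
    [FiniteDimensional ℝ V] (Φ Δ : Finset V)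
    (hΦ : EuclideanRoots.IsRootSystem Φ) (hΔ : EuclideanRoots.IsSimpleSystem Φ Δ)
    (n : ℕ) (w : EuclideanRoots.reflectionGroup Φ) :
    LinearMap.det (((w : V ≃ₗ[ℝ] V) : V →ₗ[ℝ] V).compLeft (Fin n)) =
        LinearMap.det ((w : V ≃ₗ[ℝ] V) : V →ₗ[ℝ] V) ^ n ∧
      LinearMap.det ((w : V ≃ₗ[ℝ] V) : V →ₗ[ℝ] V) ^ n =
        ∑ I ∈ EuclideanRoots.chains Φ Δ n,
          (-1 : ℝ) ^ (∑ i : Fin n, (I i.succ).card) *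
            EuclideanRoots.inducedTrivialCharacter
              (EuclideanRoots.parabolic (I (Fin.last n))) w := by
  constructor
  · rw [EuclideanRoots.det_compLeft, Fintype.card_fin]
  · rw [EuclideanRoots.chains_eq_decreasingSequences,
      EuclideanRoots.sum_decreasingSequences
        (fun I => EuclideanRoots.inducedTrivialCharacter (EuclideanRoots.parabolic I) w) _ n
        fun I hI => hΔ.sum_inducedTrivialCharacter_parabolic hΦ w hI,
      hΔ.inducedTrivialCharacter_parabolic_simpleReflections hΦ, mul_one]
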